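/- Let $W:\mathbb R\to\mathbb R$ be $C^1$ and suppose that, for some real constants $P'$ and $C$, $W(x)\ge P'\ln(|x|^2+1)+C$ for all $x\in\mathbb R$. Write $V(x)=W(x)-\frac12x^2$. For $P>0$ and a Borel probability measure $\mu$ on $\mathbb R$ put $$f_P^V(\mu)=\frac12\iint\big(W(x)+W(y)-2P\ln|x-y|\big)\,d\mu(x)d\mu(y)+\int\ln\frac{d\mu}{dx}\,d\mu$$ if $\mu\ll dx$ and $\ln\frac{d\mu}{dx}$ is $\mu$-integrable, and $f_P^V(\mu)=+\infty$ otherwise; put $I_P^V=f_P^V-\inf f_P^V$, the infimum being over all Borel probability measures on $\mathbb R$. Then: 1. For every $P\in(0,P'-1)$, $\inf f_P^V$ is finite and $I_P^V$ is strictly convex on the set of probability measures, i.e. convex, with strict inequality between any two distinct measures at which it is finite. 2. For every $P\in(0,P'-1)$, $I_P^V$ attains its minimum at a unique probability measure $\mu_P^V$. It satisfies $\mu_P^V\ll dx$; the function $\ln|x-\cdot|$ is $\mu_P^V$-integrable for every $x$; the density $\frac{d\mu_P^V}{dx}$ is positive Lebesgue-almost everywhere; there is a finite constant $\lambda_P^V$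 with $$W(x)-2P\int\ln|x-y|\,d\mu_P^V(y)+\ln\frac{d\mu_P^V}{dx}(x)=\lambda_P^V\qquad\text{for Lebesgue-a.e. }x;$$ and the support of $\mu_P^V$ is $\mathbb R$. Moreover there are constants $C_P$, $P\in(0,P'-1)$, bounded above on every compact subset of $(0,P'-1)$, such that $\frac{d\mu_P^V}{dx}(x)\le C_P(|x|+1)^{2(P-P')}$ for Lebesgue-a.e. $x$. The map $P\mapsto\inf f_P^V$ is Lipschitz on $(0,P'-1)$. 3. For probability measures $\mu,\nu$ on $\mathbb R$ let $$D(\mu,\nu)=\Big(\int_0^\infty\frac1t\Big|\int e^{itx}\,d(\mu-\nu)(x)\Big|^2dt\Big)^{1/2}\in[0,\infty].$$ Then $D$ is an extended distance (it may take the value $+\infty$, and otherwise satisfies the axioms of a distance), and $$D(\mu,\nu)=\Big(-\iint\ln|x-y|\,d(\mu-\nu)(x)d(\mu-\nu)(y)\Big)^{1/2}$$ whenever $\ln|x-y|$ is integrable for $\mu\otimes\mu$, $\mu\otimes\nu$ and $\nu\otimes\nu$ (with $\ln 0=-\infty$); this integrability holds for any two of the measures $\mu_P^V$, $P\in(0,P'-1)$.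 For every $R$ there is a finite constant $C_R$ such that for all $P_1,P_2\in(0,P'-1)$ with $P_1,P_2\le R$, $$D(\mu_{P_1}^V,\mu_{P_2}^V)\le\frac{C_R}{\min\{P_1,P_2\}}\,|P_1-P_2|.$$ -/

import Mathlib

open MeasureTheory Set
open scoped ENNReal NNReal

noncomputable section

namespace CoulombGas

/-- The extended integral `∫ g⁺ dμ - ∫ g⁻ dμ ∈ [-∞, ∞]` of a real function. It is used below only
for functions that are bounded below and for probability measures, where the subtracted term
is finite. -/
def extIntegral {α : Type*} [MeasurableSpace α] (μ : Measure α) (g : α → ℝ) : EReal :=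
  ((∫⁻ x, ENNReal.ofReal (g x) ∂μ : ℝ≥0∞) : EReal)
    - ((∫⁻ x, ENNReal.ofReal (-(g x)) ∂μ : ℝ≥0∞) : EReal)

/-- The density `dμ/dx` of `μ` with respect to Lebesgue measure, as a real function. -/
def density (μ : Measure ℝ) (x : ℝ) : ℝ := (μ.rnDeriv volume x).toReal

open scoped Classical in
/-- The functional
`f_P(μ) = 1/2 ∬ (W x + W y - 2 P ln |x - y|) dμ(x) dμ(y) + ∫ ln (dμ/dx) dμ`
if `μ ≪ dx` and `ln (dμ/dx)` is `μ`-integrable, and `f_P(μ) = +∞` otherwise.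
(The diagonal, where `Real.log 0 = 0` is a convention, is a null set in the first case.) -/
def freeEnergy (W : ℝ → ℝ) (P : ℝ) (μ : Measure ℝ) : EReal :=
  if μ ≪ volume ∧ Integrable (fun x => Real.log (density μ x)) μ then
    ((1 / 2 : ℝ) : EReal) *
        extIntegral (μ.prod μ) (fun z => W z.1 + W z.2 - 2 * P * Real.log |z.1 - z.2|)
      + ((∫ x, Real.log (density μ x) ∂μ : ℝ) : EReal)
  else ⊤

/-- `inf f_P`, the infimum over all Borel probability measures on the line. -/
def infFreeEnergy (W : ℝ → ℝ) (P : ℝ) : EReal :=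
  ⨅ μ : ProbabilityMeasure ℝ, freeEnergy W P (μ : Measure ℝ)

/-- The rate function `I_P = f_P - inf f_P`. -/
def rateFunction (W : ℝ → ℝ) (P : ℝ) (μ : Measure ℝ) : EReal :=
  freeEnergy W P μ - infFreeEnergy W P

/-- Strict convexity of an extended-valued function on the set of probability measures: convexity
everywhere, with strict inequality for distinct points of the effective domain. -/
def StrictlyConvexOnProb (F : Measure ℝ → EReal) : Prop :=
  ∀ μ ν : ProbabilityMeasure ℝ, ∀ t : ℝ, 0 < t → t < 1 →
    F (ENNReal.ofReal t • (μ : Measure ℝ) + ENNReal.ofReal (1 - t) • (ν : Measure ℝ))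
        ≤ (t : EReal) * F μ + ((1 - t : ℝ) : EReal) * F ν ∧
    (μ ≠ ν → F μ ≠ ⊤ → F ν ≠ ⊤ →
      F (ENNReal.ofReal t • (μ : Measure ℝ) + ENNReal.ofReal (1 - t) • (ν : Measure ℝ))
        < (t : EReal) * F μ + ((1 - t : ℝ) : EReal) * F ν)

/-- The (extended) distance `D(μ, ν) = (∫₀^∞ t⁻¹ |∫ e^{itx} d(μ - ν)(x)|² dt)^{1/2} ∈ [0, ∞]`. -/
def logDist (μ ν : Measure ℝ) : ℝ≥0∞ :=
  (∫⁻ t in Ioi (0 : ℝ), ENNReal.ofReal (t⁻¹ * ‖charFun μ t - charFun ν t‖ ^ 2)) ^ (1 / 2 : ℝ)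

/-- The mutual logarithmic energy `∬ ln |x - y| dμ(x) dν(y)`. -/
def mutualLog (μ ν : Measure ℝ) : ℝ :=
  ∫ z, Real.log |z.1 - z.2| ∂(μ.prod ν)

/-- The mutual logarithmic energy is a convergent integral. Since `ln 0 = -∞`, this includes that
the diagonal is a null set. -/
def FiniteMutualLog (μ ν : Measure ℝ) : Prop :=
  (μ.prod ν) {z | z.1 = z.2} = 0 ∧ Integrable (fun z : ℝ × ℝ => Real.log |z.1 - z.2|) (μ.prod ν)

/-- `- ∬ ln |x - y| d(μ - ν)(x) d(μ - ν)(y)`, expanded by bilinearity. -/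
def logEnergyDiff (μ ν : Measure ℝ) : ℝ :=
  -(mutualLog μ μ - mutualLog μ ν - mutualLog ν μ + mutualLog ν ν)

end CoulombGas

end

/-!
Write `ℓ(x) = ln (1 + x²)`. Since `2 ln |x - y| ≤ ℓ(x) + ℓ(y)` and `P' - P > 1`, the free energy
controls the logarithmic moment `∫ ℓ dμ`, and its finiteness is equivalent to admissibility: finite
entropy, finite logarithmic moment and integrable potential
(`Admissible`, `Admissible.of_freeEnergy_ne_top`, `freeEnergy_of_admissible`). A measure of finite
entropy has a logarithmic potential that is bounded below uniformly in space, by Young's inequality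
for `a ln a - a` and `exp` (`neg_negLogBound_le_logPotential`), so all mutual logarithmic energies of
admissible measures converge.

*Fourier formula.* From `-2 ln |x| = ∫₀^∞ (e^{-x²u} - e^{-u}) / u du`, an absolutely convergent
integral, and the Gaussian formula for `e^{-x²u}`, two applications of Fubini's theorem give
`-∬ ln |x - y| d(μ - ν) d(μ - ν) = ∫₀^∞ |μ̂ - ν̂|² / t dt` (`logEnergyDiff_eq_lintegral`). Hence the
logarithmic energy of a nonzero neutral charge is positive, which makes the free energy strictly
convex (`energy_mix`).

*Existence.* At a midpoint the entropy gap of two measures bounds the `L¹` distance of their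
densities (`integral_abs_sub_density_le`). The densities of a minimizing sequence are therefore
Cauchy in `L¹`; a subsequence converges almost everywhere, and Fatou's lemma, applied to the relative
entropy with respect to `(1 + x²)^{-3/4}` and to the remaining nonnegative interaction, gives lower
semicontinuity (`energy_le_of_tendsto`, `exists_minimizer`).

*Euler–Lagrange equation.* A minimizer `μ` also minimizes the functional linearized in the
interaction, `ν ↦ ∫ (W - 2P ∫ ln |· - y| dμ(y)) dν + ∫ ln (dν/dx) dν`, whose only minimizer is a Gibbs
measure, by the Gibbs variational principle (`gibbs_variational`, `IsMinimizer.density_eq`).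
Positivity, the equation itself and the decay of the density are read off from the Gibbs form. All
constants are uniform in `P ∈ (0, P' - 1)`, because the exponent `3/4` of the reference weight stays
below `P' - P` by a fixed margin.

*Dependence on `P`.* The free energy is affine in `P` with slope `-∬ ln |x - y| dμ dμ`, bounded along
the minimizers; hence its infimum is Lipschitz. Pairing the difference of the Euler–Lagrange
equations for `P₁`, `P₂` with `μ₂ - μ₁` yields
`(P₁ + P₂) D² + S = (P₂ - P₁) ∫ (U₁ + U₂) d(μ₂ - μ₁)`, with `U₁`, `U₂` the logarithmic potentials and
`S` the symmetrized relative entropy; the right-hand side is at most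
`S` plus a constant times `(P₂ - P₁)²` (`mul_sub_le_sq_add`, `exists_logEnergyDiff_bound`).
-/

open MeasureTheory Set
open scoped ENNReal NNReal

noncomputable section

namespace CoulombGas

open Filter Topology ProbabilityTheory

/-! ### A Gaussian representation of the logarithm -/

theorem lintegral_exp_neg_mul_Ioi {s : ℝ} (hs : 0 < s) :
    ∫⁻ u in Ioi (0 : ℝ), ENNReal.ofReal (Real.exp (-(s * u))) = ENNReal.ofReal s⁻¹ := by
  have hi : IntegrableOn (fun u : ℝ => Real.exp (-(s * u))) (Ioi 0) := by
    simpa [neg_mul] using integrableOn_exp_mul_Ioi (a := -s) (by linarith) 0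
  rw [← ofReal_integral_eq_lintegral_ofReal hi (ae_of_all _ fun _ => (Real.exp_pos _).le)]
  congr 1
  have := integral_exp_mul_Ioi (a := -s) (by linarith) 0
  simp only [neg_mul] at this
  rw [this]; simp

/-- Frullani's integral for the exponential function, as a Lebesgue integral. -/
theorem lintegral_frullani_exp {α β : ℝ} (hα : 0 < α) (hαβ : α ≤ β) :
    ∫⁻ u in Ioi (0 : ℝ), ENNReal.ofReal ((Real.exp (-(α * u)) - Real.exp (-(β * u))) / u)
      = ENNReal.ofReal (Real.log β - Real.log α) := by
  have h1 : ∀ u ∈ Ioi (0 : ℝ),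
      ENNReal.ofReal ((Real.exp (-(α * u)) - Real.exp (-(β * u))) / u)
        = ∫⁻ s in Ioc α β, ENNReal.ofReal (Real.exp (-(s * u))) := by
    intro u hu
    have hu' : (u : ℝ) ≠ 0 := ne_of_gt hu
    have hc : Continuous fun s : ℝ => Real.exp (-(s * u)) := by fun_prop
    rw [← ofReal_integral_eq_lintegral_ofReal
      (hc.integrableOn_Icc.mono_set Ioc_subset_Icc_self)
      (ae_of_all _ fun _ => (Real.exp_pos _).le), ← intervalIntegral.integral_of_le hαβ]
    congr 1
    have hd : ∀ s ∈ uIcc α β, HasDerivAt (fun s : ℝ => -(Real.exp (-(s * u)) / u))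
        (Real.exp (-(s * u))) s := by
      intro s _
      have := ((((hasDerivAt_id s).mul_const u).neg).exp.div_const u).neg
      refine this.congr_deriv ?_
      simp only [id]
      field_simp
      simp [mul_comm]
    rw [intervalIntegral.integral_eq_sub_of_hasDerivAt hd (hc.intervalIntegrable _ _)]
    ring
  rw [setLIntegral_congr_fun measurableSet_Ioi h1, lintegral_lintegral_swap]
  · have h2 : ∀ s ∈ Ioc α β, ∫⁻ u in Ioi (0 : ℝ), ENNReal.ofReal (Real.exp (-(s * u)))
        = ENNReal.ofReal s⁻¹ := fun s hs => lintegral_exp_neg_mul_Ioi (hα.trans hs.1)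
    rw [setLIntegral_congr_fun measurableSet_Ioc h2]
    have hc : ContinuousOn (fun s : ℝ => s⁻¹) (Icc α β) :=
      continuousOn_inv₀.mono fun s hs => ne_of_gt (hα.trans_le hs.1)
    rw [← ofReal_integral_eq_lintegral_ofReal
      (hc.integrableOn_Icc.mono_set Ioc_subset_Icc_self)
      ((ae_restrict_iff' measurableSet_Ioc).2
        (ae_of_all _ fun s hs => inv_nonneg.2 (hα.trans hs.1).le)),
      ← intervalIntegral.integral_of_le hαβ, integral_inv_of_pos hα (hα.trans_le hαβ),
      Real.log_div (hα.trans_le hαβ).ne' hα.ne']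
  · exact Measurable.aemeasurable (by fun_prop)

/-- The integrand of the representation `-2 log |x| = ∫₀^∞ (e^{-x²u} - e^{-u}) / u du`. -/
def logKernel (x u : ℝ) : ℝ := (Real.exp (-(x ^ 2 * u)) - Real.exp (-u)) / u

theorem measurable_logKernel : Measurable fun p : ℝ × ℝ => logKernel p.1 p.2 := by
  unfold logKernel; fun_prop

theorem lintegral_enorm_logKernel {x : ℝ} (hx : x ≠ 0) :
    ∫⁻ u in Ioi (0 : ℝ), ‖logKernel x u‖ₑ = ENNReal.ofReal (2 * |Real.log (|x|)|) := by
  have hx2 : 0 < x ^ 2 := by positivity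
  have hl : Real.log (x ^ 2) = 2 * Real.log |x| := by
    rw [← sq_abs, Real.log_pow]; norm_num
  rcases le_total (x ^ 2) 1 with h | h
  · have e : ∀ u ∈ Ioi (0 : ℝ), ‖logKernel x u‖ₑ
        = ENNReal.ofReal ((Real.exp (-(x ^ 2 * u)) - Real.exp (-(1 * u))) / u) := by
      intro u hu
      rw [one_mul, ← Real.enorm_eq_ofReal]; · rfl
      have : Real.exp (-u) ≤ Real.exp (-(x ^ 2 * u)) :=
        Real.exp_le_exp.2 (by nlinarith [mem_Ioi.1 hu])
      exact div_nonneg (by linarith) (le_of_lt hu)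
    rw [setLIntegral_congr_fun measurableSet_Ioi e, lintegral_frullani_exp hx2 h]
    have : Real.log (x ^ 2) ≤ 0 := Real.log_nonpos hx2.le h
    rw [abs_of_nonpos (by linarith), Real.log_one, hl]; congr 1; ring
  · have e : ∀ u ∈ Ioi (0 : ℝ), ‖logKernel x u‖ₑ
        = ENNReal.ofReal ((Real.exp (-(1 * u)) - Real.exp (-(x ^ 2 * u))) / u) := by
      intro u hu
      rw [one_mul, ← enorm_neg, ← Real.enorm_eq_ofReal]
      · congr 1; unfold logKernel; ring
      have : Real.exp (-(x ^ 2 * u)) ≤ Real.exp (-u) :=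
        Real.exp_le_exp.2 (by nlinarith [mem_Ioi.1 hu])
      exact div_nonneg (by linarith) (le_of_lt hu)
    rw [setLIntegral_congr_fun measurableSet_Ioi e, lintegral_frullani_exp one_pos h]
    have : 0 ≤ Real.log (x ^ 2) := Real.log_nonneg h
    rw [abs_of_nonneg (by linarith), Real.log_one, hl]; congr 1; ring

theorem integral_logKernel {x : ℝ} (hx : x ≠ 0) :
    ∫ u in Ioi (0 : ℝ), logKernel x u = -2 * Real.log |x| := by
  have hx2 : 0 < x ^ 2 := by positivity
  have hl : Real.log (x ^ 2) = 2 * Real.log |x| := by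
    rw [← sq_abs, Real.log_pow]; norm_num
  have hm : AEStronglyMeasurable (logKernel x) (volume.restrict (Ioi (0 : ℝ))) :=
    (measurable_logKernel.comp (measurable_prodMk_left (x := x))).aestronglyMeasurable
  have key := lintegral_enorm_logKernel hx
  rcases le_total (x ^ 2) 1 with h | h
  · have : Real.log (x ^ 2) ≤ 0 := Real.log_nonpos hx2.le h
    have hpos : 0 ≤ᵐ[volume.restrict (Ioi (0 : ℝ))] logKernel x := by
      refine (ae_restrict_iff' measurableSet_Ioi).2 (ae_of_all _ fun u hu => ?_)
      have : Real.exp (-u) ≤ Real.exp (-(x ^ 2 * u)) :=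
        Real.exp_le_exp.2 (by nlinarith [mem_Ioi.1 hu])
      exact div_nonneg (by linarith) (le_of_lt hu)
    rw [integral_eq_lintegral_of_nonneg_ae hpos hm,
      lintegral_congr_ae (hpos.mono fun u hu => (Real.enorm_eq_ofReal hu).symm), key,
      ENNReal.toReal_ofReal (by positivity), abs_of_nonpos (by linarith)]
    ring
  · have : 0 ≤ Real.log (x ^ 2) := Real.log_nonneg h
    have hpos : 0 ≤ᵐ[volume.restrict (Ioi (0 : ℝ))] fun u => -logKernel x u := by
      refine (ae_restrict_iff' measurableSet_Ioi).2 (ae_of_all _ fun u hu => ?_)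
      have : Real.exp (-(x ^ 2 * u)) ≤ Real.exp (-u) :=
        Real.exp_le_exp.2 (by nlinarith [mem_Ioi.1 hu])
      change 0 ≤ -logKernel x u
      unfold logKernel
      rw [← neg_div]
      exact div_nonneg (by linarith) (le_of_lt hu)
    have e : ∫ u in Ioi (0 : ℝ), -logKernel x u = 2 * Real.log |x| := by
      rw [integral_eq_lintegral_of_nonneg_ae hpos hm.neg,
        lintegral_congr_ae (hpos.mono fun u hu => (Real.enorm_eq_ofReal hu).symm)]
      simp only [enorm_neg]
      rw [key, ENNReal.toReal_ofReal (by positivity), abs_of_nonneg (by linarith)]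
    rw [integral_neg] at e
    linarith

/-- The Gaussian interaction `∬ e^{-u(x-y)²} dμ(x) dν(y)`. -/
def gaussEnergy (μ ν : Measure ℝ) (u : ℝ) : ℝ :=
  ∫ z, Real.exp (-((z.1 - z.2) ^ 2 * u)) ∂(μ.prod ν)

section
variable (μ ν : Measure ℝ) [IsProbabilityMeasure μ] [IsProbabilityMeasure ν]

theorem ae_ne_of_finiteMutualLog {μ ν : Measure ℝ} (h : FiniteMutualLog μ ν) :
    ∀ᵐ z ∂(μ.prod ν), z.1 - z.2 ≠ 0 := by
  have := h.1
  rw [ae_iff]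
  simpa [sub_eq_zero] using this

theorem integrable_logKernel_prod (μ ν : Measure ℝ) [SFinite ν] (h : FiniteMutualLog μ ν) :
    Integrable (fun p : (ℝ × ℝ) × ℝ => logKernel (p.1.1 - p.1.2) p.2)
      ((μ.prod ν).prod (volume.restrict (Ioi (0 : ℝ)))) := by
  have hm : Measurable (fun p : (ℝ × ℝ) × ℝ => logKernel (p.1.1 - p.1.2) p.2) :=
    measurable_logKernel.comp
      (f := fun p : (ℝ × ℝ) × ℝ => (p.1.1 - p.1.2, p.2)) (by fun_prop)
  refine ⟨hm.aestronglyMeasurable, ?_⟩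
  have h3 : ∀ᵐ z ∂(μ.prod ν), ∫⁻ u in Ioi (0 : ℝ), ‖logKernel (z.1 - z.2) u‖ₑ
      = ENNReal.ofReal (2 * |Real.log (|z.1 - z.2|)|) := by
    filter_upwards [ae_ne_of_finiteMutualLog h] with z hz using lintegral_enorm_logKernel hz
  rw [HasFiniteIntegral, lintegral_prod _ hm.enorm.aemeasurable, lintegral_congr_ae h3]
  have h2 : ∫⁻ z, ‖2 * |Real.log (|z.1 - z.2|)|‖ₑ ∂(μ.prod ν) < ∞ := (h.2.abs.const_mul 2).2
  refine lt_of_le_of_lt (lintegral_mono fun z => ?_) h2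
  exact (Real.enorm_eq_ofReal (by positivity)).ge

theorem integral_logKernel_prod (u : ℝ) (hu : 0 < u) :
    ∫ z, logKernel (z.1 - z.2) u ∂(μ.prod ν) = (gaussEnergy μ ν u - Real.exp (-u)) / u := by
  unfold logKernel gaussEnergy
  rw [integral_div, integral_sub]
  · simp
  · refine Integrable.of_bound (Measurable.aestronglyMeasurable (by fun_prop)) 1
      (ae_of_all _ fun z => ?_)
    rw [Real.norm_of_nonneg (Real.exp_pos _).le, Real.exp_le_one_iff]
    have : 0 ≤ (z.1 - z.2) ^ 2 * u := by positivity
    linarith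
  · exact integrable_const _

theorem integrable_gaussEnergy (h : FiniteMutualLog μ ν) :
    IntegrableOn (fun u => (gaussEnergy μ ν u - Real.exp (-u)) / u) (Ioi 0) := by
  refine ((integrable_logKernel_prod μ ν h).integral_prod_right).congr ?_
  exact (ae_restrict_iff' measurableSet_Ioi).2
    (ae_of_all _ fun u hu => integral_logKernel_prod μ ν u hu)

theorem integral_gaussEnergy_sub_exp (h : FiniteMutualLog μ ν) :
    ∫ u in Ioi (0 : ℝ), (gaussEnergy μ ν u - Real.exp (-u)) / u = -2 * mutualLog μ ν := by
  rw [← setIntegral_congr_fun measurableSet_Ioi fun u hu => integral_logKernel_prod μ ν u hu,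
    integral_integral_swap (f := fun (u : ℝ) (z : ℝ × ℝ) => logKernel (z.1 - z.2) u)
      (integrable_logKernel_prod μ ν h).swap, mutualLog,
    ← integral_const_mul]
  exact integral_congr_ae ((ae_ne_of_finiteMutualLog h).mono fun z hz => integral_logKernel hz)

/-- The Gaussian `e^{-ux²}` is the characteristic function of a centred normal law of variance
`2u`, so that its interaction energy is a nonnegative quadratic form in characteristic functions. -/
theorem gaussEnergy_eq_integral_charFun (u : ℝ≥0) :
    (gaussEnergy μ ν u : ℂ) = ∫ t, charFun μ t * (starRingEnd ℂ) (charFun ν t)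
      ∂(gaussianReal 0 (2 * u)) := by
  have h1 : ∀ z : ℝ × ℝ, ((Real.exp (-((z.1 - z.2) ^ 2 * u)) : ℝ) : ℂ)
      = ∫ t, Complex.exp (t * z.1 * Complex.I) * Complex.exp (t * (-z.2) * Complex.I)
        ∂(gaussianReal 0 (2 * u)) := by
    intro z
    have := charFun_gaussianReal (μ := 0) (v := 2 * u) (z.1 - z.2)
    rw [charFun_apply_real] at this
    simp_rw [← Complex.exp_add]
    have e : ∀ t : ℝ, (t : ℂ) * z.1 * Complex.I + t * (-z.2) * Complex.I
      = (z.1 - z.2 : ℝ) * t * Complex.I := by intro t; push_cast; ring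
    simp_rw [e]
    rw [this]
    push_cast
    congr 1
    ring
  have hI : Integrable (fun p : (ℝ × ℝ) × ℝ =>
      Complex.exp (p.2 * p.1.1 * Complex.I) * Complex.exp (p.2 * (-p.1.2) * Complex.I))
      ((μ.prod ν).prod (gaussianReal 0 (2 * u))) := by
    refine Integrable.of_bound (Measurable.aestronglyMeasurable (by fun_prop)) 1
      (ae_of_all _ fun p => ?_)
    rw [← Complex.exp_add, show (p.2 : ℂ) * p.1.1 * Complex.I + p.2 * (-p.1.2) * Complex.I
      = ((p.2 * (p.1.1 - p.1.2) : ℝ) : ℂ) * Complex.I by push_cast; ring,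
      Complex.norm_exp_ofReal_mul_I]
  rw [gaussEnergy, ← integral_complex_ofReal, integral_congr_ae (ae_of_all _ h1),
    integral_integral_swap hI]
  refine integral_congr_ae (ae_of_all _ fun t => ?_)
  simp only
  rw [integral_prod_mul (fun x : ℝ => Complex.exp (t * x * Complex.I))
    (fun y : ℝ => Complex.exp (t * (-y) * Complex.I)), ← charFun_neg, charFun_apply_real,
    charFun_apply_real]
  simp

theorem integrable_charFun_mul (u : ℝ≥0) :
    Integrable (fun t => charFun μ t * (starRingEnd ℂ) (charFun ν t))
      (gaussianReal 0 (2 * u)) := by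
  refine Integrable.of_bound (Measurable.aestronglyMeasurable ?_) 1 (ae_of_all _ fun t => ?_)
  · exact (measurable_charFun).mul (Complex.continuous_conj.measurable.comp measurable_charFun)
  · rw [norm_mul, RCLike.norm_conj]
    exact mul_le_one₀ (norm_charFun_le_one _) (norm_nonneg _) (norm_charFun_le_one _)

theorem gaussEnergy_diff (u : ℝ≥0) :
    gaussEnergy μ μ u - gaussEnergy μ ν u - gaussEnergy ν μ u + gaussEnergy ν ν u
      = ∫ t, ‖charFun μ t - charFun ν t‖ ^ 2 ∂(gaussianReal 0 (2 * u)) := by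
  apply Complex.ofReal_injective
  have i₁ := integrable_charFun_mul μ μ u
  have i₂ := integrable_charFun_mul μ ν u
  have i₃ := integrable_charFun_mul ν μ u
  have i₄ := integrable_charFun_mul ν ν u
  have i₅ : Integrable (fun t => charFun μ t * (starRingEnd ℂ) (charFun μ t)
      - charFun μ t * (starRingEnd ℂ) (charFun ν t)) (gaussianReal 0 (2 * u)) := i₁.sub i₂
  have i₆ : Integrable (fun t => charFun μ t * (starRingEnd ℂ) (charFun μ t)
      - charFun μ t * (starRingEnd ℂ) (charFun ν t)
      - charFun ν t * (starRingEnd ℂ) (charFun μ t)) (gaussianReal 0 (2 * u)) := i₅.sub i₃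
  have e : ∀ t, ((‖charFun μ t - charFun ν t‖ ^ 2 : ℝ) : ℂ)
      = charFun μ t * (starRingEnd ℂ) (charFun μ t) - charFun μ t * (starRingEnd ℂ) (charFun ν t)
        - charFun ν t * (starRingEnd ℂ) (charFun μ t)
        + charFun ν t * (starRingEnd ℂ) (charFun ν t) := by
    intro t
    rw [← Complex.normSq_eq_norm_sq, ← Complex.mul_conj, map_sub]
    ring
  rw [← integral_complex_ofReal, integral_congr_ae (ae_of_all _ e),
    integral_add i₆ i₄, integral_sub i₅ i₃, integral_sub i₁ i₂]
  push_cast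
  rw [gaussEnergy_eq_integral_charFun, gaussEnergy_eq_integral_charFun,
    gaussEnergy_eq_integral_charFun, gaussEnergy_eq_integral_charFun]

end

/-! ### The Fourier formula for the logarithmic energy -/

theorem finiteMutualLog_symm {μ ν : Measure ℝ} [SFinite μ] [SFinite ν]
    (h : FiniteMutualLog μ ν) : FiniteMutualLog ν μ := by
  constructor
  · rw [← Measure.prod_swap, Measure.map_apply measurable_swap
      (measurableSet_eq_fun measurable_fst measurable_snd)]
    convert h.1 using 2
    ext z
    simp [eq_comm]
  · refine h.2.swap.congr (ae_of_all _ fun z => ?_)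
    simp only [Function.comp_apply, Prod.fst_swap, Prod.snd_swap]
    rw [abs_sub_comm]

/-- Integrating the Gaussian densities over all scales gives the weight `1 / |t|` of the Fourier
formula. -/
theorem lintegral_gaussianPDFReal_div {t : ℝ} (ht : t ≠ 0) :
    ∫⁻ u in Ioi (0 : ℝ), ENNReal.ofReal (u⁻¹ * gaussianPDFReal 0 (2 * u.toNNReal) t)
      = ENNReal.ofReal |t|⁻¹ := by
  have ha : 0 < t ^ 2 / 4 := by positivity
  have hπ : 0 < Real.sqrt Real.pi := Real.sqrt_pos.2 Real.pi_pos
  -- the substitution `u ↦ u⁻¹` turns the integral into a Gamma integral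
  have h1 := integral_comp_rpow_Ioi
    (fun y : ℝ => y ^ ((1 / 2 : ℝ) - 1) * Real.exp (-(t ^ 2 / 4 * y))) (p := -1) (by norm_num)
  rw [Real.integral_rpow_mul_exp_neg_mul_Ioi (by norm_num) ha, Real.Gamma_one_half_eq] at h1
  have h2 : ((1 : ℝ) / (t ^ 2 / 4)) ^ (1 / 2 : ℝ) = 2 * |t|⁻¹ := by
    rw [← Real.sqrt_eq_rpow, show (1 : ℝ) / (t ^ 2 / 4) = (2 * |t|⁻¹) ^ 2 by
      rw [mul_pow, inv_pow, sq_abs]; field_simp; norm_num]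
    exact Real.sqrt_sq (by positivity)
  rw [h2] at h1
  have h3 : ∀ u ∈ Ioi (0 : ℝ), u⁻¹ * gaussianPDFReal 0 (2 * u.toNNReal) t
      = (2 * Real.sqrt Real.pi)⁻¹ * ((|(-1 : ℝ)| * u ^ ((-1 : ℝ) - 1)) •
        ((u ^ (-1 : ℝ)) ^ ((1 / 2 : ℝ) - 1) * Real.exp (-(t ^ 2 / 4 * u ^ (-1 : ℝ))))) := by
    intro u hu
    have hu' : 0 < u := hu
    have hsu : 0 < Real.sqrt u := Real.sqrt_pos.2 hu'
    have e1 : u ^ ((-1 : ℝ) - 1) = (u ^ 2)⁻¹ := by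
      rw [show ((-1 : ℝ) - 1) = -(2 : ℕ) by norm_num, Real.rpow_neg hu'.le, Real.rpow_natCast]
    have e2 : (u ^ (-1 : ℝ)) ^ ((1 / 2 : ℝ) - 1) = Real.sqrt u := by
      rw [← Real.rpow_mul hu'.le, Real.sqrt_eq_rpow]; norm_num
    have e3 : Real.sqrt (2 * Real.pi * (2 * u)) = 2 * Real.sqrt Real.pi * Real.sqrt u := by
      rw [show 2 * Real.pi * (2 * u) = 2 ^ 2 * (Real.pi * u) by ring,
        Real.sqrt_mul (by norm_num), Real.sqrt_mul Real.pi_pos.le, Real.sqrt_sq (by norm_num)]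
      ring
    have e4 : -(t - 0) ^ 2 / (2 * (2 * u)) = -(t ^ 2 / 4 * u⁻¹) := by field_simp; ring
    have e5 : u = Real.sqrt u * Real.sqrt u := (Real.mul_self_sqrt hu'.le).symm
    rw [e1, e2, Real.rpow_neg_one, gaussianPDFReal]
    push_cast
    rw [Real.coe_toNNReal u hu'.le, e3, e4, abs_neg, abs_one, smul_eq_mul]
    have e6 : u⁻¹ * (2 * Real.sqrt Real.pi * Real.sqrt u)⁻¹
        = (2 * Real.sqrt Real.pi)⁻¹ * (1 * (u ^ 2)⁻¹ * Real.sqrt u) := by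
      field_simp
      rw [sq, ← e5]
    rw [← mul_assoc, e6]; ring
  have h4 : ∫ u in Ioi (0 : ℝ), u⁻¹ * gaussianPDFReal 0 (2 * u.toNNReal) t = |t|⁻¹ := by
    rw [setIntegral_congr_fun measurableSet_Ioi h3, integral_const_mul, h1]
    field_simp
  have h5 : IntegrableOn (fun u : ℝ => u⁻¹ * gaussianPDFReal 0 (2 * u.toNNReal) t) (Ioi 0) := by
    by_contra h
    rw [integral_undef h] at h4
    exact (inv_pos.2 (abs_pos.2 ht)).ne h4
  rw [← h4, ofReal_integral_eq_lintegral_ofReal h5]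
  exact (ae_restrict_iff' measurableSet_Ioi).2 (ae_of_all _ fun u (hu : 0 < u) =>
    mul_nonneg (inv_nonneg.2 hu.le) (gaussianPDFReal_nonneg _ _ _))

section
variable (μ ν : Measure ℝ) [IsProbabilityMeasure μ] [IsProbabilityMeasure ν]

theorem measurable_normSq_charFun_sub :
    Measurable fun t => ENNReal.ofReal (‖charFun μ t - charFun ν t‖ ^ 2) :=
  ((measurable_charFun.sub measurable_charFun).norm.pow_const 2).ennreal_ofReal

theorem norm_charFun_sub_neg (μ ν : Measure ℝ) (t : ℝ) :
    ‖charFun μ (-t) - charFun ν (-t)‖ = ‖charFun μ t - charFun ν t‖ := by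
  rw [charFun_neg, charFun_neg, ← map_sub, RCLike.norm_conj]

theorem lintegral_univ_charFun_sub (μ ν : Measure ℝ) :
    ∫⁻ t : ℝ, ENNReal.ofReal (‖charFun μ t - charFun ν t‖ ^ 2) * ENNReal.ofReal |t|⁻¹
      = 2 * ∫⁻ t in Ioi (0 : ℝ), ENNReal.ofReal (t⁻¹ * ‖charFun μ t - charFun ν t‖ ^ 2) := by
  have hm : MeasurableEmbedding (fun x : ℝ => -x) :=
    (Homeomorph.neg ℝ).measurableEmbedding
  have h1 : ∫⁻ t in Ioi (0 : ℝ),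
      ENNReal.ofReal (‖charFun μ t - charFun ν t‖ ^ 2) * ENNReal.ofReal |t|⁻¹
      = ∫⁻ t in Ioi (0 : ℝ), ENNReal.ofReal (t⁻¹ * ‖charFun μ t - charFun ν t‖ ^ 2) := by
    refine setLIntegral_congr_fun measurableSet_Ioi fun t (ht : 0 < t) => ?_
    rw [← ENNReal.ofReal_mul (by positivity), abs_of_pos ht, mul_comm]
  have h2 : ∫⁻ t in Iio (0 : ℝ),
      ENNReal.ofReal (‖charFun μ t - charFun ν t‖ ^ 2) * ENNReal.ofReal |t|⁻¹
      = ∫⁻ t in Ioi (0 : ℝ),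
      ENNReal.ofReal (‖charFun μ t - charFun ν t‖ ^ 2) * ENNReal.ofReal |t|⁻¹ := by
    have := (Measure.measurePreserving_neg (volume : Measure ℝ)).setLIntegral_comp_emb hm
      (fun t => ENNReal.ofReal (‖charFun μ t - charFun ν t‖ ^ 2) * ENNReal.ofReal |t|⁻¹)
      (Ioi (0 : ℝ))
    rw [image_neg_Ioi, neg_zero] at this
    rw [← this]
    simp_rw [norm_charFun_sub_neg, abs_neg]
  rw [← lintegral_add_compl _ (measurableSet_Ioi (a := (0 : ℝ))), compl_Ioi,
    setLIntegral_congr (Iio_ae_eq_Iic (a := (0 : ℝ))).symm, h2, h1, two_mul]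

theorem integral_gaussEnergy_diff (hμμ : FiniteMutualLog μ μ) (hμν : FiniteMutualLog μ ν)
    (hνν : FiniteMutualLog ν ν) :
    IntegrableOn (fun u : ℝ => u⁻¹ * ∫ t, ‖charFun μ t - charFun ν t‖ ^ 2
      ∂(gaussianReal 0 (2 * u.toNNReal))) (Ioi 0) ∧
    ∫ u in Ioi (0 : ℝ), u⁻¹ * ∫ t, ‖charFun μ t - charFun ν t‖ ^ 2
      ∂(gaussianReal 0 (2 * u.toNNReal)) = 2 * logEnergyDiff μ ν := by
  have hνμ := finiteMutualLog_symm hμν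
  have i₁ := integrable_gaussEnergy μ μ hμμ
  have i₂ := integrable_gaussEnergy μ ν hμν
  have i₃ := integrable_gaussEnergy ν μ hνμ
  have i₄ := integrable_gaussEnergy ν ν hνν
  have i₅ : IntegrableOn (fun u => (gaussEnergy μ μ u - Real.exp (-u)) / u
    - (gaussEnergy μ ν u - Real.exp (-u)) / u) (Ioi 0) := i₁.sub i₂
  have i₆ : IntegrableOn (fun u => (gaussEnergy μ μ u - Real.exp (-u)) / u
    - (gaussEnergy μ ν u - Real.exp (-u)) / u - (gaussEnergy ν μ u - Real.exp (-u)) / u)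
    (Ioi 0) := i₅.sub i₃
  have i₇ : IntegrableOn (fun u => (gaussEnergy μ μ u - Real.exp (-u)) / u
    - (gaussEnergy μ ν u - Real.exp (-u)) / u - (gaussEnergy ν μ u - Real.exp (-u)) / u
    + (gaussEnergy ν ν u - Real.exp (-u)) / u) (Ioi 0) := i₆.add i₄
  have e : ∀ u ∈ Ioi (0 : ℝ), (gaussEnergy μ μ u - Real.exp (-u)) / u
    - (gaussEnergy μ ν u - Real.exp (-u)) / u - (gaussEnergy ν μ u - Real.exp (-u)) / u
    + (gaussEnergy ν ν u - Real.exp (-u)) / u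
    = u⁻¹ * ∫ t, ‖charFun μ t - charFun ν t‖ ^ 2 ∂(gaussianReal 0 (2 * u.toNNReal)) := by
    intro u hu
    have := gaussEnergy_diff μ ν u.toNNReal
    rw [Real.coe_toNNReal u (le_of_lt hu)] at this
    rw [← this]
    ring
  refine ⟨i₇.congr_fun e measurableSet_Ioi, ?_⟩
  rw [← setIntegral_congr_fun measurableSet_Ioi e, integral_add i₆ i₄, integral_sub i₅ i₃,
    integral_sub i₁ i₂, integral_gaussEnergy_sub_exp μ μ hμμ,
    integral_gaussEnergy_sub_exp μ ν hμν, integral_gaussEnergy_sub_exp ν μ hνμ,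
    integral_gaussEnergy_sub_exp ν ν hνν, logEnergyDiff]
  ring

/-- The left-hand side is the contribution of the scale `u` to the logarithmic energy; here it is
written as a Lebesgue integral over frequencies, ready for Tonelli's theorem. -/
theorem ofReal_integral_gaussianReal {u : ℝ} (hu : 0 < u) :
    ENNReal.ofReal (u⁻¹ * ∫ t, ‖charFun μ t - charFun ν t‖ ^ 2
      ∂(gaussianReal 0 (2 * u.toNNReal)))
    = ∫⁻ t : ℝ, ENNReal.ofReal (‖charFun μ t - charFun ν t‖ ^ 2)
        * ENNReal.ofReal (u⁻¹ * gaussianPDFReal 0 (2 * u.toNNReal) t) := by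
  have hi : Integrable (fun t => ‖charFun μ t - charFun ν t‖ ^ 2)
      (gaussianReal 0 (2 * u.toNNReal)) := by
    refine Integrable.of_bound ((measurable_charFun.sub measurable_charFun).norm.pow_const
      2).aestronglyMeasurable 4 (ae_of_all _ fun t => ?_)
    rw [Real.norm_of_nonneg (by positivity)]
    have : ‖charFun μ t - charFun ν t‖ ≤ 2 := (norm_sub_le _ _).trans (by
      linarith [norm_charFun_le_one (μ := μ) t, norm_charFun_le_one (μ := ν) t])
    nlinarith [norm_nonneg (charFun μ t - charFun ν t)]
  have hu0 : 2 * u.toNNReal ≠ 0 := by simpa using hu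
  rw [ENNReal.ofReal_mul (by positivity),
    ofReal_integral_eq_lintegral_ofReal hi (ae_of_all _ fun _ => by positivity),
    gaussianReal_of_var_ne_zero 0 hu0,
    lintegral_withDensity_eq_lintegral_mul _ (measurable_gaussianPDF _ _)
      (measurable_normSq_charFun_sub μ ν),
    ← lintegral_const_mul _ ((measurable_gaussianPDF _ _).mul
      (measurable_normSq_charFun_sub μ ν))]
  refine lintegral_congr fun t => ?_
  rw [Pi.mul_apply, gaussianPDF, ENNReal.ofReal_mul (by positivity)]
  ring

/-- The Fourier formula for the logarithmic energy of a neutral charge distribution. -/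
theorem logEnergyDiff_eq_lintegral (hμμ : FiniteMutualLog μ μ) (hμν : FiniteMutualLog μ ν)
    (hνν : FiniteMutualLog ν ν) :
    0 ≤ logEnergyDiff μ ν ∧ ENNReal.ofReal (logEnergyDiff μ ν)
      = ∫⁻ t in Ioi (0 : ℝ), ENNReal.ofReal (t⁻¹ * ‖charFun μ t - charFun ν t‖ ^ 2) := by
  obtain ⟨hi, he⟩ := integral_gaussEnergy_diff μ ν hμμ hμν hνν
  have hpos : ∀ u ∈ Ioi (0 : ℝ), 0 ≤ u⁻¹ * ∫ t, ‖charFun μ t - charFun ν t‖ ^ 2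
      ∂(gaussianReal 0 (2 * u.toNNReal)) := fun u (hu : 0 < u) =>
    mul_nonneg (by positivity) (integral_nonneg fun _ => by positivity)
  have h0 : 0 ≤ 2 * logEnergyDiff μ ν := he ▸ setIntegral_nonneg measurableSet_Ioi hpos
  refine ⟨by linarith, ?_⟩
  have h2 : ENNReal.ofReal (2 * logEnergyDiff μ ν)
      = 2 * ∫⁻ t in Ioi (0 : ℝ), ENNReal.ofReal (t⁻¹ * ‖charFun μ t - charFun ν t‖ ^ 2) := by
    rw [← he, ofReal_integral_eq_lintegral_ofReal hi
      ((ae_restrict_iff' measurableSet_Ioi).2 (ae_of_all _ hpos)),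
      setLIntegral_congr_fun measurableSet_Ioi
        (fun u hu => ofReal_integral_gaussianReal μ ν hu), lintegral_lintegral_swap,
      ← lintegral_univ_charFun_sub]
    · refine lintegral_congr_ae ?_
      filter_upwards [Measure.ae_ne volume (0 : ℝ)] with t ht
      rw [lintegral_const_mul', lintegral_gaussianPDFReal_div ht]
      exact ENNReal.ofReal_ne_top
    · refine Measurable.aemeasurable (Measurable.mul ?_ (Measurable.ennreal_ofReal ?_))
      · exact (measurable_normSq_charFun_sub μ ν).comp measurable_snd
      · unfold gaussianPDFReal
        fun_prop
  rw [ENNReal.ofReal_mul (by norm_num), ENNReal.ofReal_ofNat] at h2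
  exact (ENNReal.mul_right_inj (by norm_num) (by norm_num)).1 h2

theorem logDist_eq_sqrt (hμμ : FiniteMutualLog μ μ) (hμν : FiniteMutualLog μ ν)
    (hνν : FiniteMutualLog ν ν) :
    logDist μ ν = ENNReal.ofReal (Real.sqrt (logEnergyDiff μ ν)) := by
  obtain ⟨h0, h⟩ := logEnergyDiff_eq_lintegral μ ν hμμ hμν hνν
  rw [logDist, ← h, ENNReal.ofReal_rpow_of_nonneg h0 (by norm_num), Real.sqrt_eq_rpow]

/-! ### The extended distance -/

theorem logDist_comm (μ ν : Measure ℝ) : logDist μ ν = logDist ν μ := by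
  unfold logDist
  simp_rw [norm_sub_rev (charFun μ _)]

theorem logDist_self (μ : Measure ℝ) : logDist μ μ = 0 := by
  simp [logDist]

variable {μ ν} in
theorem eq_of_logDist_eq_zero (h : logDist μ ν = 0) : μ = ν := by
  rw [logDist, ENNReal.rpow_eq_zero_iff_of_pos (by norm_num), lintegral_eq_zero_iff] at h
  swap
  · exact (measurable_inv.mul
      ((measurable_charFun.sub measurable_charFun).norm.pow_const 2)).ennreal_ofReal
  rw [Filter.EventuallyEq, ae_restrict_iff' measurableSet_Ioi] at h
  have hc : Continuous fun t => charFun μ t - charFun ν t :=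
    (continuous_charFun).sub continuous_charFun
  have hpos : ∀ t ∈ Ioi (0 : ℝ), charFun μ t - charFun ν t = 0 := by
    have hae : (fun t => charFun μ t - charFun ν t) =ᵐ[volume.restrict (Ioi (0 : ℝ))]
        fun _ => 0 := by
      rw [Filter.EventuallyEq, ae_restrict_iff' measurableSet_Ioi]
      filter_upwards [h] with t ht ht0
      have ht0' : 0 < t := ht0
      have := ht ht0
      simp only [Pi.zero_apply, ENNReal.ofReal_eq_zero] at this
      have h3 : 0 ≤ t⁻¹ * ‖charFun μ t - charFun ν t‖ ^ 2 := by positivity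
      have h4 := le_antisymm this h3
      have h5 : t⁻¹ ≠ 0 := by positivity
      simpa [h5, ht0'.ne'] using h4
    exact Measure.eqOn_open_of_ae_eq hae isOpen_Ioi hc.continuousOn continuousOn_const
  refine Measure.ext_of_charFun (funext fun t => ?_)
  rcases lt_trichotomy t 0 with ht | rfl | ht
  · have := hpos (-t) (by simpa using ht)
    rw [← norm_eq_zero, norm_charFun_sub_neg, norm_eq_zero] at this
    exact sub_eq_zero.1 this
  · simp
  · exact sub_eq_zero.1 (hpos t ht)

/-- Minkowski's inequality in `L²(dt / t)`. -/
theorem logDist_triangle (ξ : Measure ℝ) [IsProbabilityMeasure ξ] :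
    logDist μ ξ ≤ logDist μ ν + logDist ν ξ := by
  have e : ∀ μ ν : Measure ℝ, logDist μ ν = (∫⁻ t in Ioi (0 : ℝ),
      (ENNReal.ofReal (Real.sqrt t⁻¹ * ‖charFun μ t - charFun ν t‖)) ^ (2 : ℝ)) ^ (1 / 2 : ℝ) := by
    intro μ ν
    unfold logDist
    congr 1
    refine setLIntegral_congr_fun measurableSet_Ioi fun t (ht : 0 < t) => ?_
    rw [ENNReal.ofReal_rpow_of_nonneg (by positivity) (by norm_num), Real.rpow_two, mul_pow,
      Real.sq_sqrt (by positivity)]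
  have hm : ∀ (μ ν : Measure ℝ) [IsProbabilityMeasure μ] [IsProbabilityMeasure ν],
      Measurable fun t : ℝ => ENNReal.ofReal (Real.sqrt t⁻¹ * ‖charFun μ t - charFun ν t‖) :=
    fun μ ν _ _ => ((measurable_inv.sqrt).mul
      (measurable_charFun.sub measurable_charFun).norm).ennreal_ofReal
  rw [e, e, e]
  refine le_trans ?_ (ENNReal.lintegral_Lp_add_le (hm μ ν).aemeasurable (hm ν ξ).aemeasurable
    (by norm_num : (1 : ℝ) ≤ 2))
  gcongr with t
  rw [Pi.add_apply, ← ENNReal.ofReal_add (by positivity) (by positivity), ← mul_add]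
  gcongr
  exact norm_sub_le_norm_sub_add_norm_sub _ _ _

end

/-! ### Logarithmic potentials of measures with finite entropy -/

/-- The weight `ln (1 + x²)`, which measures the growth of the confining potential. -/
def logWeight (x : ℝ) : ℝ := Real.log (1 + x ^ 2)

theorem logWeight_nonneg (x : ℝ) : 0 ≤ logWeight x :=
  Real.log_nonneg (by nlinarith [sq_nonneg x])

theorem continuous_logWeight : Continuous logWeight := by
  unfold logWeight
  exact Continuous.log (by fun_prop) fun x => by positivity

/-- This is `(x - y)² + (1 + x y)² = (1 + x²) (1 + y²)`; the diagonal is harmless because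
`Real.log 0 = 0`. -/
theorem two_log_abs_sub_le (x y : ℝ) :
    2 * Real.log |x - y| ≤ logWeight x + logWeight y := by
  rcases eq_or_ne (x - y) 0 with h | h
  · rw [h]; simpa using add_nonneg (logWeight_nonneg x) (logWeight_nonneg y)
  · unfold logWeight
    rw [← Real.log_mul (by positivity) (by positivity),
      show 2 * Real.log |x - y| = Real.log ((x - y) ^ 2) by
        rw [← sq_abs, Real.log_pow]; norm_num]
    exact Real.log_le_log (by positivity) (by nlinarith [sq_nonneg (1 + x * y)])

theorem density_nonneg (μ : Measure ℝ) (x : ℝ) : 0 ≤ density μ x := ENNReal.toReal_nonneg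

theorem measurable_density (μ : Measure ℝ) : Measurable (density μ) :=
  (Measure.measurable_rnDeriv _ _).ennreal_toReal

/-- A measure with a density of finite entropy and a finite logarithmic moment. -/
structure FiniteEntropy (μ : Measure ℝ) : Prop where
  ac : μ ≪ volume
  integrable_log : Integrable (fun x => Real.log (density μ x)) μ
  integrable_logWeight : Integrable logWeight μ

/-- The entropy term `∫ ln (dμ/dx) dμ`. -/
def entropy (μ : Measure ℝ) : ℝ := ∫ x, Real.log (density μ x) ∂μ

/-- The logarithmic potential `∫ ln |x - y| dμ(y)`. -/
def logPotential (μ : Measure ℝ) (x : ℝ) : ℝ := ∫ y, Real.log |x - y| ∂μ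

section density
variable {μ : Measure ℝ} [IsProbabilityMeasure μ]

theorem integral_density_mul (h : μ ≪ volume) (f : ℝ → ℝ) :
    ∫ x, density μ x * f x = ∫ x, f x ∂μ :=
  integral_toReal_rnDeriv_mul h

theorem integrable_density_mul_iff (h : μ ≪ volume) {f : ℝ → ℝ} :
    Integrable (fun x => density μ x * f x) ↔ Integrable f μ :=
  integrable_rnDeriv_smul_iff (E := ℝ) h

theorem integrable_density : Integrable (density μ) := Measure.integrable_toReal_rnDeriv

theorem integral_density (h : μ ≪ volume) : ∫ x, density μ x = 1 := by
  have := integral_density_mul h (fun _ => 1)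
  simpa using this

theorem withDensity_density (h : μ ≪ volume) :
    volume.withDensity (fun x => ENNReal.ofReal (density μ x)) = μ := by
  conv_rhs => rw [← Measure.withDensity_rnDeriv_eq μ volume h]
  refine withDensity_congr_ae ?_
  filter_upwards [Measure.rnDeriv_lt_top μ volume] with x hx
  exact ENNReal.ofReal_toReal hx.ne

end density

/-- Young's inequality for the pair of convex functions `a ln a - a` and `exp`. -/
theorem mul_le_mul_log_add_exp {a : ℝ} (ha : 0 ≤ a) (b : ℝ) :
    a * b ≤ a * Real.log a - a + Real.exp b := by
  rcases ha.eq_or_lt with rfl | ha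
  · simp [(Real.exp_pos b).le]
  · have h := Real.add_one_le_exp (b - Real.log a)
    rw [Real.exp_sub, Real.exp_log ha, le_div_iff₀ ha] at h
    linarith

/-- The negative part of `ln |z|`. -/
def negLog (z : ℝ) : ℝ := max (-Real.log |z|) 0

theorem measurable_negLog : Measurable negLog := by unfold negLog; fun_prop

theorem negLog_nonneg (z : ℝ) : 0 ≤ negLog z := le_max_right _ _

theorem abs_log_le (x y : ℝ) :
    |Real.log (|x - y|)| ≤ (logWeight x + logWeight y) / 2 + 2 * negLog (x - y) := by
  have h1 := two_log_abs_sub_le x y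
  have h2 : -Real.log |x - y| ≤ negLog (x - y) := le_max_left _ _
  have h3 := negLog_nonneg (x - y)
  exact abs_le.2 ⟨by linarith [logWeight_nonneg x, logWeight_nonneg y], by linarith⟩

/-- The integrable singularity `|z|^{-1/2}` on `(-1, 1)`, which dominates that of the logarithm. -/
def sqrtSing : ℝ → ℝ := (Ioo (-1 : ℝ) 1).indicator fun z => |z| ^ (-(1 / 2) : ℝ)

theorem sqrtSing_nonneg (z : ℝ) : 0 ≤ sqrtSing z :=
  indicator_nonneg (fun _ _ => by positivity) z

theorem integrable_sqrtSing : Integrable sqrtSing := by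
  unfold sqrtSing
  rw [integrable_indicator_iff measurableSet_Ioo]
  have h1 : IntervalIntegrable (fun z : ℝ => |z| ^ (-(1 / 2) : ℝ)) volume 0 1 := by
    refine (intervalIntegral.intervalIntegrable_rpow' (r := -(1 / 2)) (by norm_num)).congr ?_
    intro z hz
    rw [uIoc_of_le zero_le_one] at hz
    simp only [abs_of_pos hz.1]
  have h2 : IntervalIntegrable (fun z : ℝ => |z| ^ (-(1 / 2) : ℝ)) volume (-1) 0 := by
    have := h1.comp_sub_left 0
    simp only [zero_sub, abs_neg, neg_zero] at this
    exact this.symm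
  have := (intervalIntegrable_iff_integrableOn_Ioo_of_le (by norm_num)).1 (h2.trans h1)
  exact this

theorem mul_negLog_le {a : ℝ} (ha : 0 ≤ a) (z : ℝ) :
    a * negLog z ≤ 2 * (|a * Real.log a| + sqrtSing z) := by
  have hs := sqrtSing_nonneg z
  have h0 := abs_nonneg (a * Real.log a)
  rcases eq_or_ne z 0 with rfl | hz
  · simp [negLog]; positivity
  by_cases h : |z| < 1
  · have hz' : 0 < |z| := abs_pos.2 hz
    have hn : negLog z = -Real.log |z| := max_eq_left (by linarith [Real.log_neg hz' h])
    have hb := mul_le_mul_log_add_exp ha (Real.log |z| * (-(1 / 2)))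
    rw [← Real.rpow_def_of_pos hz'] at hb
    have he : sqrtSing z = |z| ^ (-(1 / 2) : ℝ) := indicator_of_mem (mem_Ioo.2 (abs_lt.1 h)) _
    rw [hn, he]
    linarith [le_abs_self (a * Real.log a)]
  · have hn : negLog z = 0 := max_eq_right (by linarith [Real.log_nonneg (not_lt.1 h)])
    rw [hn]; linarith

/-- A bound for the negative part of the logarithmic potential, uniform in space. -/
def negLogBound (μ : Measure ℝ) : ℝ :=
  2 * ((∫ x, |Real.log (density μ x)| ∂μ) + ∫ z, sqrtSing z)

theorem negLogBound_nonneg (μ : Measure ℝ) : 0 ≤ negLogBound μ := by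
  have h1 : 0 ≤ ∫ x, |Real.log (density μ x)| ∂μ := integral_nonneg fun _ => abs_nonneg _
  have h2 : 0 ≤ ∫ z, sqrtSing z := integral_nonneg sqrtSing_nonneg
  unfold negLogBound; linarith

section potential
variable {μ : Measure ℝ} [IsProbabilityMeasure μ]

theorem FiniteEntropy.noAtoms {μ : Measure ℝ} (h : FiniteEntropy μ) : NullSingletonClass μ :=
  ⟨fun x => h.ac (measure_singleton x)⟩

/-- Young's inequality bounds the integral by the entropy and the mass of `sqrtSing`, whatever the
point `x`. -/
theorem integral_negLog_le (h : FiniteEntropy μ) (x : ℝ) :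
    Integrable (fun y => negLog (x - y)) μ ∧ ∫ y, negLog (x - y) ∂μ ≤ negLogBound μ := by
  have hi : Integrable (fun y => 2 * (|density μ y * Real.log (density μ y)| + sqrtSing (x - y))) :=
    ((((integrable_density_mul_iff h.ac).2 h.integrable_log).abs).add
      (integrable_sqrtSing.comp_sub_left x)).const_mul 2
  have hle : ∀ y, density μ y * negLog (x - y)
      ≤ 2 * (|density μ y * Real.log (density μ y)| + sqrtSing (x - y)) := fun y =>
    mul_negLog_le (density_nonneg μ y) (x - y)
  have hi2 : Integrable (fun y => density μ y * negLog (x - y)) := by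
    refine hi.mono' ((measurable_density μ).mul
      (measurable_negLog.comp (by fun_prop))).aestronglyMeasurable (ae_of_all _ fun y => ?_)
    rw [Real.norm_of_nonneg (mul_nonneg (density_nonneg μ y) (negLog_nonneg _))]
    exact hle y
  refine ⟨(integrable_density_mul_iff h.ac).1 hi2, ?_⟩
  rw [← integral_density_mul h.ac]
  refine (integral_mono hi2 hi hle).trans_eq ?_
  rw [integral_const_mul, integral_add ((integrable_density_mul_iff h.ac).2 h.integrable_log).abs
    (integrable_sqrtSing.comp_sub_left x), integral_sub_left_eq_self, negLogBound,
    ← integral_density_mul h.ac]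
  simp_rw [abs_mul, abs_of_nonneg (density_nonneg μ _)]

theorem integrable_log_abs_sub (h : FiniteEntropy μ) (x : ℝ) :
    Integrable (fun y => Real.log |x - y|) μ := by
  refine (((((integrable_const (logWeight x)).add h.integrable_logWeight).div_const 2).add
    ((integral_negLog_le h x).1.const_mul 2))).mono'
    (Measurable.aestronglyMeasurable (by fun_prop)) (ae_of_all _ fun y => ?_)
  exact abs_log_le x y

theorem logPotential_le (h : FiniteEntropy μ) (x : ℝ) :
    logPotential μ x ≤ (logWeight x + ∫ y, logWeight y ∂μ) / 2 := by
  have : (logWeight x + ∫ y, logWeight y ∂μ) / 2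
      = ∫ y, (logWeight x + logWeight y) / 2 ∂μ := by
    rw [integral_div, integral_add (integrable_const _) h.integrable_logWeight]
    simp
  rw [this]
  refine integral_mono (integrable_log_abs_sub h x)
    (((integrable_const _).add h.integrable_logWeight).div_const 2) fun y => ?_
  simp only
  linarith [two_log_abs_sub_le x y]

theorem neg_negLogBound_le_logPotential (h : FiniteEntropy μ) (x : ℝ) :
    -negLogBound μ ≤ logPotential μ x := by
  have h1 := (integral_negLog_le h x)
  have h2 : -∫ y, Real.log |x - y| ∂μ ≤ ∫ y, negLog (x - y) ∂μ := by
    rw [← integral_neg]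
    exact integral_mono (integrable_log_abs_sub h x).neg h1.1 fun y => le_max_left _ _
  unfold logPotential
  linarith [h1.2]

theorem measurable_logPotential : Measurable (logPotential μ) := by
  have : StronglyMeasurable (fun z : ℝ × ℝ => Real.log |z.1 - z.2|) :=
    Measurable.stronglyMeasurable (by fun_prop)
  exact this.integral_prod_right'.measurable

variable {ν : Measure ℝ} [IsProbabilityMeasure ν]

theorem finiteMutualLog (hν : Integrable logWeight ν) (h : FiniteEntropy μ) :
    FiniteMutualLog ν μ := by
  have := h.noAtoms
  refine ⟨?_, ?_⟩
  · rw [Measure.measure_prod_null (measurableSet_eq_fun measurable_fst measurable_snd)]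
    refine ae_of_all _ fun x => ?_
    have : Prod.mk x ⁻¹' {z : ℝ × ℝ | z.1 = z.2} = {x} := by ext y; simp [eq_comm]
    simp [this]
  · have hm : AEStronglyMeasurable (fun z : ℝ × ℝ => negLog (z.1 - z.2)) (ν.prod μ) :=
      (measurable_negLog.comp (by fun_prop)).aestronglyMeasurable
    have h1 : Integrable (fun z : ℝ × ℝ => negLog (z.1 - z.2)) (ν.prod μ) := by
      rw [integrable_prod_iff hm]
      refine ⟨ae_of_all _ fun x => (integral_negLog_le h x).1, ?_⟩
      refine Integrable.of_bound hm.norm.integral_prod_right' (negLogBound μ)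
        (ae_of_all _ fun x => ?_)
      rw [Real.norm_of_nonneg (integral_nonneg fun _ => norm_nonneg _)]
      simp_rw [Real.norm_of_nonneg (negLog_nonneg _)]
      exact (integral_negLog_le h x).2
    refine (((hν.comp_fst μ).add (h.integrable_logWeight.comp_snd ν)).div_const 2 |>.add
      (h1.const_mul 2)).mono' (Measurable.aestronglyMeasurable (by fun_prop))
      (ae_of_all _ fun z => abs_log_le z.1 z.2)

theorem mutualLog_eq_integral_logPotential (hν : Integrable logWeight ν) (h : FiniteEntropy μ) :
    Integrable (logPotential μ) ν ∧ mutualLog ν μ = ∫ x, logPotential μ x ∂ν :=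
  ⟨(finiteMutualLog hν h).2.integral_prod_left, integral_prod _ (finiteMutualLog hν h).2⟩

theorem mutualLog_comm (μ ν : Measure ℝ) [SFinite μ] [SFinite ν] :
    mutualLog μ ν = mutualLog ν μ := by
  unfold mutualLog
  rw [← integral_prod_swap]
  simp_rw [Prod.fst_swap, Prod.snd_swap, abs_sub_comm]

theorem mutualLog_le (hν : Integrable logWeight ν) (h : FiniteEntropy μ) :
    mutualLog ν μ ≤ ((∫ x, logWeight x ∂ν) + ∫ x, logWeight x ∂μ) / 2 := by
  obtain ⟨hi, he⟩ := mutualLog_eq_integral_logPotential hν h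
  rw [he]
  have : ((∫ x, logWeight x ∂ν) + ∫ x, logWeight x ∂μ) / 2
      = ∫ x, (logWeight x + ∫ y, logWeight y ∂μ) / 2 ∂ν := by
    rw [integral_div, integral_add hν (integrable_const _)]
    simp
  rw [this]
  exact integral_mono hi ((hν.add (integrable_const _)).div_const 2) (logPotential_le h)

theorem neg_negLogBound_le_mutualLog (hν : Integrable logWeight ν) (h : FiniteEntropy μ) :
    -negLogBound μ ≤ mutualLog ν μ := by
  obtain ⟨hi, he⟩ := mutualLog_eq_integral_logPotential hν h
  rw [he]
  have : -negLogBound μ = ∫ _, -negLogBound μ ∂ν := by simp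
  rw [this]
  exact integral_mono (integrable_const _) hi (neg_negLogBound_le_logPotential h)

end potential

/-! ### Effective domain of the free energy -/

/-- A measure of finite free energy for the potential `W`. -/
structure Admissible (W : ℝ → ℝ) (μ : Measure ℝ) : Prop extends FiniteEntropy μ where
  integrable_potential : Integrable W μ

/-- The value of the free energy on admissible measures. -/
def energy (W : ℝ → ℝ) (P : ℝ) (μ : Measure ℝ) : ℝ :=
  (∫ x, W x ∂μ) - P * mutualLog μ μ + entropy μ

theorem extIntegral_of_integrable {α : Type*} [MeasurableSpace α] {μ : Measure α} {g : α → ℝ}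
    (hg : Integrable g μ) : extIntegral μ g = ((∫ x, g x ∂μ : ℝ) : EReal) := by
  have h1 : ∫⁻ x, ENNReal.ofReal (g x) ∂μ ≠ ∞ := hg.lintegral_lt_top.ne
  have h2 : ∫⁻ x, ENNReal.ofReal (-(g x)) ∂μ ≠ ∞ := hg.neg.lintegral_lt_top.ne
  rw [integral_eq_lintegral_pos_part_sub_lintegral_neg_part hg, extIntegral, EReal.coe_sub,
    EReal.coe_ennreal_toReal h1, EReal.coe_ennreal_toReal h2]

theorem integrable_of_extIntegral_ne_top {α : Type*} [MeasurableSpace α] {μ : Measure α}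
    [IsProbabilityMeasure μ] {g : α → ℝ} (hm : Measurable g) {c : ℝ} (hc : ∀ x, c ≤ g x)
    (h : extIntegral μ g ≠ ⊤) : Integrable g μ := by
  have h2 : ∫⁻ x, ENNReal.ofReal (-(g x)) ∂μ ≠ ∞ := by
    refine ne_of_lt (lt_of_le_of_lt (lintegral_mono (g := fun _ => ENNReal.ofReal (-c))
      fun x => ENNReal.ofReal_le_ofReal (neg_le_neg (hc x))) ?_)
    simp
  have h1 : ∫⁻ x, ENNReal.ofReal (g x) ∂μ ≠ ∞ := by
    intro h1
    apply h
    rw [extIntegral, h1, ← EReal.coe_ennreal_toReal h2]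
    exact EReal.top_sub_coe _
  have hpos : Integrable (fun x => max (g x) 0) μ := by
    refine ⟨(hm.max measurable_const).aestronglyMeasurable, ?_⟩
    rw [HasFiniteIntegral, lintegral_congr fun x => Real.enorm_eq_ofReal (le_max_right _ _)]
    simpa [ENNReal.ofReal_max] using h1.lt_top
  refine (hpos.add (integrable_const |c|)).mono' hm.aestronglyMeasurable
    (ae_of_all _ fun x => ?_)
  simp only [Pi.add_apply]
  refine abs_le.2 ⟨?_, ?_⟩
  · linarith [hc x, neg_abs_le c, le_max_right (g x) 0]
  · linarith [abs_nonneg c, le_max_left (g x) 0]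

section
variable {W : ℝ → ℝ} {μ : Measure ℝ} [IsProbabilityMeasure μ]

theorem freeEnergy_of_admissible (h : Admissible W μ) (P : ℝ) :
    freeEnergy W P μ = ((energy W P μ : ℝ) : EReal) := by
  have h1 : Integrable (fun z : ℝ × ℝ => W z.1 + W z.2) (μ.prod μ) :=
    (h.integrable_potential.comp_fst μ).add (h.integrable_potential.comp_snd μ)
  have h2 := (finiteMutualLog h.integrable_logWeight h.toFiniteEntropy).2.const_mul (2 * P)
  have h3 : ∫ z, (W z.1 + W z.2 - 2 * P * Real.log |z.1 - z.2|) ∂(μ.prod μ)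
      = 2 * (∫ x, W x ∂μ) - 2 * P * mutualLog μ μ := by
    rw [integral_sub h1 h2, integral_const_mul, integral_add (h.integrable_potential.comp_fst μ)
      (h.integrable_potential.comp_snd μ), integral_fun_fst, integral_fun_snd, mutualLog]
    simp; ring
  have h4 : Integrable (fun z : ℝ × ℝ => W z.1 + W z.2 - 2 * P * Real.log |z.1 - z.2|)
      (μ.prod μ) := h1.sub h2
  rw [freeEnergy, if_pos ⟨h.ac, h.integrable_log⟩, extIntegral_of_integrable h4, h3,
    ← EReal.coe_mul, ← EReal.coe_add, energy, entropy]
  congr 1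
  ring

/-- The integrand of the free energy dominates `(P' - P) (ℓ(x) + ℓ(y))`, up to a constant. Its
integrability therefore gives the logarithmic moment, then the convergence of the logarithmic
energy, and finally the integrability of `W`. -/
theorem Admissible.of_freeEnergy_ne_top (hW : Measurable W) {P P' C : ℝ} (hP : 0 < P)
    (hPP' : P < P') (hlow : ∀ x, P' * logWeight x + C ≤ W x)
    (h : freeEnergy W P μ ≠ ⊤) : Admissible W μ := by
  rw [freeEnergy] at h
  split_ifs at h with hc
  swap
  · exact absurd rfl h
  obtain ⟨hac, hent⟩ := hc
  set g : ℝ × ℝ → ℝ := fun z => W z.1 + W z.2 - 2 * P * Real.log |z.1 - z.2| with hg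
  have hgm : Measurable g := by fun_prop
  have hglow : ∀ z, (P' - P) * (logWeight z.1 + logWeight z.2) + 2 * C ≤ g z := by
    intro z
    have := mul_le_mul_of_nonneg_left (two_log_abs_sub_le z.1 z.2) hP.le
    simp only [hg]
    linarith [hlow z.1, hlow z.2]
  have hglow' : ∀ z, 2 * C ≤ g z := fun z => by
    have := mul_nonneg (sub_nonneg.2 hPP'.le)
      (add_nonneg (logWeight_nonneg z.1) (logWeight_nonneg z.2))
    linarith [hglow z]
  have hext : extIntegral (μ.prod μ) g ≠ ⊤ := by
    intro htop
    rw [htop, EReal.coe_mul_top_of_pos (by norm_num)] at h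
    exact h (EReal.top_add_coe _)
  have hgi : Integrable g (μ.prod μ) := integrable_of_extIntegral_ne_top hgm hglow' hext
  have hd : 0 < P' - P := sub_pos.2 hPP'
  have hl : Integrable logWeight μ := by
    have : Integrable (fun z : ℝ × ℝ => logWeight z.1) (μ.prod μ) := by
      refine ((hgi.sub (integrable_const (2 * C))).div_const (P' - P)).mono'
        (continuous_logWeight.comp continuous_fst).aestronglyMeasurable (ae_of_all _ fun z => ?_)
      rw [Real.norm_of_nonneg (logWeight_nonneg _), Pi.sub_apply, le_div_iff₀ hd]
      nlinarith [hglow z, mul_nonneg hd.le (logWeight_nonneg z.2)]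
    simpa using this.integral_prod_left
  have hfe : FiniteEntropy μ := ⟨hac, hent, hl⟩
  refine ⟨hfe, ?_⟩
  have hlog := (finiteMutualLog hl hfe).2.const_mul (2 * P)
  have hWC : ∀ x, C ≤ W x := fun x => by
    have := mul_nonneg (hP.trans hPP').le (logWeight_nonneg x)
    linarith [hlow x]
  have : Integrable (fun z : ℝ × ℝ => W z.1) (μ.prod μ) := by
    refine ((hgi.add hlog).add (integrable_const (3 * |C|))).mono'
      (hW.comp measurable_fst).aestronglyMeasurable (ae_of_all _ fun z => ?_)
    have h1 := hWC z.1
    have h2 := hWC z.2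
    simp only [Pi.add_apply, hg]
    refine abs_le.2 ⟨?_, ?_⟩ <;> linarith [neg_abs_le C, abs_nonneg C]
  simpa using this.integral_prod_left

/-! ### The Gibbs variational principle -/

/-- The equality case of Young's inequality `mul_le_mul_log_add_exp`. -/
theorem eq_exp_of_mul_eq {a b : ℝ} (ha : 0 ≤ a)
    (h : a * b = a * Real.log a - a + Real.exp b) : a = Real.exp b := by
  rcases ha.eq_or_lt with rfl | ha
  · simpa using h
  · by_contra hne
    have hb : b - Real.log a ≠ 0 := by
      intro hb
      apply hne
      rw [sub_eq_zero.1 hb, Real.exp_log ha]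
    have h' := Real.add_one_lt_exp hb
    rw [Real.exp_sub, Real.exp_log ha, lt_div_iff₀ ha] at h'
    linarith

/-- The Gibbs measure `e^{-T} / Z` minimizes `∫ T dμ + ∫ ln (dμ/dx) dμ`, and it is the only
minimizer. -/
theorem gibbs_variational (h : FiniteEntropy μ) {T : ℝ → ℝ}
    (hT : Integrable (fun x => Real.exp (-T x))) (hTμ : Integrable T μ) :
    -Real.log (∫ x, Real.exp (-T x)) ≤ entropy μ + ∫ x, T x ∂μ ∧
    (entropy μ + ∫ x, T x ∂μ ≤ -Real.log (∫ x, Real.exp (-T x)) →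
      ∀ᵐ x, density μ x = Real.exp (-T x) / ∫ x, Real.exp (-T x)) := by
  set Z := ∫ x, Real.exp (-T x) with hZ
  have hZpos : 0 < Z := integral_exp_pos hT
  set φ : ℝ → ℝ := fun x => density μ x * Real.log (density μ x) - density μ x
    + Real.exp (-T x) / Z - density μ x * (-T x - Real.log Z) with hφ
  have hexp : ∀ x, Real.exp (-T x - Real.log Z) = Real.exp (-T x) / Z := fun x => by
    rw [Real.exp_sub, Real.exp_log hZpos]
  have hφ0 : ∀ x, 0 ≤ φ x := by
    intro x
    have := mul_le_mul_log_add_exp (density_nonneg μ x) (-T x - Real.log Z)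
    rw [hexp] at this
    simp only [hφ]; linarith
  have i₁ := (integrable_density_mul_iff h.ac).2 h.integrable_log
  have i₂ : Integrable (density μ) := integrable_density
  have i₃ := hT.div_const Z
  have i₄ : Integrable (fun x => density μ x * (-T x - Real.log Z)) :=
    (integrable_density_mul_iff h.ac).2 (hTμ.neg.sub (integrable_const _))
  have i₅ : Integrable (fun x => density μ x * Real.log (density μ x) - density μ x) := i₁.sub i₂
  have i₆ : Integrable (fun x => density μ x * Real.log (density μ x) - density μ x
    + Real.exp (-T x) / Z) := i₅.add i₃
  have hφi : Integrable φ := i₆.sub i₄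
  have i₇ : Integrable (fun x => -T x) μ := hTμ.neg
  have hφe : ∫ x, φ x = entropy μ + (∫ x, T x ∂μ) + Real.log Z := by
    rw [hφ, integral_sub i₆ i₄, integral_add i₅ i₃, integral_sub i₁ i₂, integral_density h.ac,
      integral_density_mul h.ac, integral_density_mul h.ac, integral_div, ← hZ,
      div_self hZpos.ne', integral_sub i₇ (integrable_const _), integral_neg, entropy]
    simp; ring
  have h0 : 0 ≤ ∫ x, φ x := integral_nonneg hφ0
  refine ⟨by linarith, fun hle => ?_⟩
  have hz : ∫ x, φ x = 0 := le_antisymm (by linarith) h0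
  filter_upwards [(integral_eq_zero_iff_of_nonneg hφ0 hφi).1 hz] with x hx
  rw [← hexp]
  refine eq_exp_of_mul_eq (density_nonneg μ x) ?_
  rw [hexp]
  simp only [hφ, Pi.zero_apply] at hx
  linarith

end

/-! ### Convexity -/

/-- The convex combination `t μ + (1 - t) ν`. -/
def mix (t : ℝ) (μ ν : Measure ℝ) : Measure ℝ :=
  ENNReal.ofReal t • μ + ENNReal.ofReal (1 - t) • ν

section mix
variable {W : ℝ → ℝ} {μ ν : Measure ℝ} [IsProbabilityMeasure μ] [IsProbabilityMeasure ν] {t : ℝ}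

theorem isProbabilityMeasure_mix (ht0 : 0 ≤ t) (ht1 : t ≤ 1) :
    IsProbabilityMeasure (mix t μ ν) := by
  constructor
  simp only [mix, Measure.add_apply, Measure.smul_apply, measure_univ, smul_eq_mul, mul_one]
  rw [← ENNReal.ofReal_add ht0 (by linarith)]
  simp

theorem integrable_mix {μ ν : Measure ℝ} {f : ℝ → ℝ} (hμ : Integrable f μ) (hν : Integrable f ν) :
    Integrable f (mix t μ ν) :=
  (hμ.smul_measure ENNReal.ofReal_ne_top).add_measure (hν.smul_measure ENNReal.ofReal_ne_top)

theorem integral_mix {μ ν : Measure ℝ} (ht0 : 0 ≤ t) (ht1 : t ≤ 1) {f : ℝ → ℝ} (hμ : Integrable f μ)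
    (hν : Integrable f ν) :
    ∫ x, f x ∂(mix t μ ν) = t * (∫ x, f x ∂μ) + (1 - t) * ∫ x, f x ∂ν := by
  rw [mix, integral_add_measure (hμ.smul_measure ENNReal.ofReal_ne_top)
    (hν.smul_measure ENNReal.ofReal_ne_top), integral_smul_measure, integral_smul_measure,
    ENNReal.toReal_ofReal ht0, ENNReal.toReal_ofReal (by linarith), smul_eq_mul, smul_eq_mul]

theorem density_mix (ht0 : 0 ≤ t) (ht1 : t ≤ 1) :
    ∀ᵐ x, density (mix t μ ν) x = t * density μ x + (1 - t) * density ν x := by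
  have : IsFiniteMeasure (ENNReal.ofReal t • μ) := μ.smul_finite ENNReal.ofReal_ne_top
  have : IsFiniteMeasure (ENNReal.ofReal (1 - t) • ν) := ν.smul_finite ENNReal.ofReal_ne_top
  filter_upwards [Measure.rnDeriv_add (ENNReal.ofReal t • μ) (ENNReal.ofReal (1 - t) • ν) volume,
    Measure.rnDeriv_smul_left_of_ne_top μ volume (r := ENNReal.ofReal t) ENNReal.ofReal_ne_top,
    Measure.rnDeriv_smul_left_of_ne_top ν volume (r := ENNReal.ofReal (1 - t))
      ENNReal.ofReal_ne_top,
    Measure.rnDeriv_lt_top μ volume, Measure.rnDeriv_lt_top ν volume] with x h1 h2 h3 h4 h5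
  rw [density, mix, h1, Pi.add_apply, h2, h3, Pi.smul_apply, Pi.smul_apply, smul_eq_mul,
    smul_eq_mul, ENNReal.toReal_add (ENNReal.mul_ne_top ENNReal.ofReal_ne_top h4.ne)
      (ENNReal.mul_ne_top ENNReal.ofReal_ne_top h5.ne), ENNReal.toReal_mul, ENNReal.toReal_mul,
    ENNReal.toReal_ofReal ht0, ENNReal.toReal_ofReal (by linarith)]
  rfl

theorem mul_log_mix_le {a b : ℝ} (ha : 0 ≤ a) (hb : 0 ≤ b) (ht0 : 0 < t) (ht1 : t < 1) :
    (t * a + (1 - t) * b) * Real.log (t * a + (1 - t) * b)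
      ≤ t * (a * Real.log a) + (1 - t) * (b * Real.log b) := by
  have := Real.convexOn_mul_log.2 (mem_Ici.2 ha) (mem_Ici.2 hb) ht0.le (sub_nonneg.2 ht1.le)
    (by ring)
  simpa only [smul_eq_mul] using this

/-- The entropy of a mixture is at least the mixture of the entropies with the entropy of the
mixing weights added. It provides the integrable minorant for the entropy of a mixture. -/
theorem mul_log_add_le_mul_log_mix {a b : ℝ} (ha : 0 ≤ a) (hb : 0 ≤ b) (ht0 : 0 < t) (ht1 : t < 1) :
    t * a * (Real.log t + Real.log a) + (1 - t) * b * (Real.log (1 - t) + Real.log b)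
      ≤ (t * a + (1 - t) * b) * Real.log (t * a + (1 - t) * b) := by
  have key : ∀ {u v : ℝ} (s : ℝ), 0 ≤ u → 0 ≤ v → 0 < s →
      s * u * (Real.log s + Real.log u) ≤ s * u * Real.log (s * u + v) := by
    intro u v s hu hv hs
    rcases hu.eq_or_lt with rfl | hu
    · simp
    · rw [← Real.log_mul hs.ne' hu.ne']
      gcongr
      linarith
  have h1 := key t ha (mul_nonneg (sub_nonneg.2 ht1.le) hb) ht0
  have h2 := key (1 - t) hb (mul_nonneg ht0.le ha) (sub_pos.2 ht1)
  rw [add_comm ((1 - t) * b)] at h2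
  rw [add_mul]
  linarith

theorem FiniteEntropy.mix (hμ : FiniteEntropy μ) (hν : FiniteEntropy ν) (ht0 : 0 < t)
    (ht1 : t < 1) : FiniteEntropy (mix t μ ν) := by
  have hac : CoulombGas.mix t μ ν ≪ volume :=
    Measure.AbsolutelyContinuous.add_left (hμ.ac.smul_left _) (hν.ac.smul_left _)
  have := isProbabilityMeasure_mix (μ := μ) (ν := ν) ht0.le ht1.le
  refine ⟨hac, ?_, integrable_mix hμ.integrable_logWeight hν.integrable_logWeight⟩
  rw [← integrable_density_mul_iff hac]
  have i₁ := (integrable_density_mul_iff hμ.ac).2 hμ.integrable_log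
  have i₂ := (integrable_density_mul_iff hν.ac).2 hν.integrable_log
  have j₁ := (integrable_density (μ := μ)).const_mul (|t * Real.log t|)
  have j₂ := (integrable_density (μ := ν)).const_mul (|(1 - t) * Real.log (1 - t)|)
  refine (((i₁.abs.add i₂.abs).add j₁).add j₂).mono'
    ((measurable_density _).mul (measurable_density _).log).aestronglyMeasurable ?_
  filter_upwards [density_mix (μ := μ) (ν := ν) ht0.le ht1.le] with x hx
  have ha := density_nonneg μ x
  have hb := density_nonneg ν x
  rw [hx]
  simp only [Pi.add_apply]
  have h1 := mul_log_mix_le ha hb ht0 ht1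
  have h2 := mul_log_add_le_mul_log_mix ha hb ht0 ht1
  set a := density μ x
  set b := density ν x
  have e1 : |t * (a * Real.log a)| ≤ |a * Real.log a| := by
    rw [abs_mul, abs_of_pos ht0]; exact mul_le_of_le_one_left (abs_nonneg _) ht1.le
  have e2 : |(1 - t) * (b * Real.log b)| ≤ |b * Real.log b| := by
    rw [abs_mul, abs_of_pos (sub_pos.2 ht1)]
    exact mul_le_of_le_one_left (abs_nonneg _) (by linarith)
  have e3 : -(|t * Real.log t| * a) ≤ t * Real.log t * a := by
    nlinarith [neg_abs_le (t * Real.log t)]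
  have e4 : -(|(1 - t) * Real.log (1 - t)| * b) ≤ (1 - t) * Real.log (1 - t) * b := by
    nlinarith [neg_abs_le ((1 - t) * Real.log (1 - t))]
  have e5 : 0 ≤ |t * Real.log t| * a := by positivity
  have e6 : 0 ≤ |(1 - t) * Real.log (1 - t)| * b := by positivity
  have e1' := abs_le.1 e1
  have e2' := abs_le.1 e2
  refine abs_le.2 ⟨?_, ?_⟩
  · linarith [e1'.1, e2'.1]
  · linarith [e1'.2, e2'.2]

theorem Admissible.mix (hμ : Admissible W μ) (hν : Admissible W ν) (ht0 : 0 < t)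
    (ht1 : t < 1) : Admissible W (mix t μ ν) :=
  ⟨hμ.toFiniteEntropy.mix hν.toFiniteEntropy ht0 ht1,
    integrable_mix hμ.integrable_potential hν.integrable_potential⟩

theorem entropy_mix_le (hμ : FiniteEntropy μ) (hν : FiniteEntropy ν) (ht0 : 0 < t)
    (ht1 : t < 1) : entropy (CoulombGas.mix t μ ν) ≤ t * entropy μ + (1 - t) * entropy ν := by
  have hm := hμ.mix hν ht0 ht1
  have := isProbabilityMeasure_mix (μ := μ) (ν := ν) ht0.le ht1.le
  have i₁ := ((integrable_density_mul_iff hμ.ac).2 hμ.integrable_log).const_mul t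
  have i₂ := ((integrable_density_mul_iff hν.ac).2 hν.integrable_log).const_mul (1 - t)
  unfold entropy
  rw [← integral_density_mul hμ.ac, ← integral_density_mul hν.ac, ← integral_density_mul hm.ac,
    ← integral_const_mul, ← integral_const_mul, ← integral_add i₁ i₂]
  refine integral_mono_ae ((integrable_density_mul_iff hm.ac).2 hm.integrable_log) (i₁.add i₂) ?_
  filter_upwards [density_mix (μ := μ) (ν := ν) ht0.le ht1.le] with x hx
  rw [hx]
  exact mul_log_mix_le (density_nonneg μ x) (density_nonneg ν x) ht0 ht1

theorem mutualLog_mix (hμ : FiniteEntropy μ) (hν : FiniteEntropy ν) (ht0 : 0 < t) (ht1 : t < 1) :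
    mutualLog (CoulombGas.mix t μ ν) (CoulombGas.mix t μ ν)
      = t ^ 2 * mutualLog μ μ + 2 * t * (1 - t) * mutualLog μ ν + (1 - t) ^ 2 * mutualLog ν ν := by
  have hm := hμ.mix hν ht0 ht1
  have := isProbabilityMeasure_mix (μ := μ) (ν := ν) ht0.le ht1.le
  have hU : ∀ x, logPotential (CoulombGas.mix t μ ν) x
      = t * logPotential μ x + (1 - t) * logPotential ν x := fun x =>
    integral_mix ht0.le ht1.le (integrable_log_abs_sub hμ x) (integrable_log_abs_sub hν x)
  obtain ⟨i₁, e₁⟩ := mutualLog_eq_integral_logPotential hμ.integrable_logWeight hμ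
  obtain ⟨i₂, e₂⟩ := mutualLog_eq_integral_logPotential hμ.integrable_logWeight hν
  obtain ⟨i₃, e₃⟩ := mutualLog_eq_integral_logPotential hν.integrable_logWeight hμ
  obtain ⟨i₄, e₄⟩ := mutualLog_eq_integral_logPotential hν.integrable_logWeight hν
  rw [(mutualLog_eq_integral_logPotential hm.integrable_logWeight hm).2]
  simp_rw [hU]
  have i₅ : Integrable (fun x => t * logPotential μ x + (1 - t) * logPotential ν x) μ :=
    (i₁.const_mul t).add (i₂.const_mul (1 - t))
  have i₆ : Integrable (fun x => t * logPotential μ x + (1 - t) * logPotential ν x) ν :=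
    (i₃.const_mul t).add (i₄.const_mul (1 - t))
  rw [integral_mix ht0.le ht1.le i₅ i₆, integral_add (i₁.const_mul t)
    (i₂.const_mul (1 - t)), integral_add (i₃.const_mul t) (i₄.const_mul (1 - t)),
    integral_const_mul, integral_const_mul, integral_const_mul, integral_const_mul,
    ← e₁, ← e₂, ← e₃, ← e₄, mutualLog_comm ν μ]
  ring

/-- The gap in the convexity inequality is the sum of an interaction part and of the entropy gap,
which is nonnegative by `entropy_mix_le`. -/
theorem energy_mix (hμ : Admissible W μ) (hν : Admissible W ν) (ht0 : 0 < t) (ht1 : t < 1)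
    (P : ℝ) :
    energy W P (CoulombGas.mix t μ ν) = t * energy W P μ + (1 - t) * energy W P ν
      - t * (1 - t) * P * logEnergyDiff μ ν
      - (t * entropy μ + (1 - t) * entropy ν - entropy (CoulombGas.mix t μ ν)) := by
  unfold energy
  rw [mutualLog_mix hμ.toFiniteEntropy hν.toFiniteEntropy ht0 ht1,
    integral_mix ht0.le ht1.le hμ.integrable_potential hν.integrable_potential, logEnergyDiff,
    mutualLog_comm ν μ]
  ring

theorem logEnergyDiff_nonneg (hμ : FiniteEntropy μ) (hν : FiniteEntropy ν) :
    0 ≤ logEnergyDiff μ ν :=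
  (logEnergyDiff_eq_lintegral μ ν (finiteMutualLog hμ.integrable_logWeight hμ)
    (finiteMutualLog hμ.integrable_logWeight hν)
    (finiteMutualLog hν.integrable_logWeight hν)).1

theorem logEnergyDiff_pos (hμ : FiniteEntropy μ) (hν : FiniteEntropy ν) (hne : μ ≠ ν) :
    0 < logEnergyDiff μ ν := by
  refine (logEnergyDiff_nonneg hμ hν).lt_of_ne fun h => hne ?_
  apply eq_of_logDist_eq_zero
  rw [logDist_eq_sqrt μ ν (finiteMutualLog hμ.integrable_logWeight hμ)
    (finiteMutualLog hμ.integrable_logWeight hν)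
    (finiteMutualLog hν.integrable_logWeight hν), ← h]
  simp

/-- The quantitative form of `ln x ≤ x - 1` behind Pinsker's inequality. -/
theorem abs_sub_le_relEntropy {a m ε : ℝ} (ha : 0 ≤ a) (hm : 0 < m) (hε : 0 < ε) :
    |a - m| ≤ (a * Real.log a - a * Real.log m - a + m) / (2 * ε) + ε * (a + m) := by
  set r := Real.sqrt a
  set s := Real.sqrt m
  have hr : 0 ≤ r := Real.sqrt_nonneg a
  have hs : 0 < s := Real.sqrt_pos.2 hm
  have har : a = r ^ 2 := (Real.sq_sqrt ha).symm
  have hms : m = s ^ 2 := (Real.sq_sqrt hm.le).symm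
  -- the relative entropy dominates the squared Hellinger distance
  have h1 : (r - s) ^ 2 ≤ a * Real.log a - a * Real.log m - a + m := by
    rcases hr.eq_or_lt with h0 | h0
    · rw [har, ← h0, hms]; simp
    · have hl := Real.log_le_sub_one_of_pos (div_pos hs h0)
      rw [Real.log_div hs.ne' h0.ne'] at hl
      have h2 : s / r * r ^ 2 = s * r := by field_simp
      rw [har, hms, Real.log_pow, Real.log_pow]
      push_cast
      nlinarith [mul_le_mul_of_nonneg_left hl (sq_nonneg r)]
  have h2 : |a - m| = |r - s| * (r + s) := by
    rw [har, hms, sq_sub_sq, abs_mul, abs_of_pos (by linarith : 0 < r + s), mul_comm]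
  have h3 : |r - s| * (r + s) ≤ (r - s) ^ 2 / (2 * ε) + ε * (a + m) := by
    have h4 : |r - s| * (r + s) - ε / 2 * (r + s) ^ 2 ≤ (r - s) ^ 2 / (2 * ε) := by
      rw [le_div_iff₀ (by positivity), ← sq_abs (r - s)]
      nlinarith [sq_nonneg (|r - s| - ε * (r + s))]
    have h5 : ε / 2 * (r + s) ^ 2 ≤ ε * (a + m) := by
      rw [har, hms]; nlinarith [mul_nonneg hε.le (sq_nonneg (r - s))]
    linarith
  rw [h2]
  refine h3.trans ?_
  gcongr

theorem abs_sub_le_entropy_gap {a b ε : ℝ} (ha : 0 ≤ a) (hb : 0 ≤ b) (hε : 0 < ε) :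
    |a - b| ≤ (1 / 2 * (a * Real.log a) + 1 / 2 * (b * Real.log b)
      - (1 / 2 * a + 1 / 2 * b) * Real.log (1 / 2 * a + 1 / 2 * b)) / ε + 2 * ε * (a + b) := by
  rcases (add_nonneg ha hb).eq_or_lt with h0 | h0
  · have ha0 : a = 0 := by linarith
    have hb0 : b = 0 := by linarith
    simp [ha0, hb0]
  · set m := 1 / 2 * a + 1 / 2 * b with hm
    have hm0 : 0 < m := by rw [hm]; linarith
    have h1 := abs_sub_le_relEntropy ha hm0 hε
    have h2 := abs_sub_le_relEntropy hb hm0 hε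
    have h3 : |a - b| ≤ |a - m| + |b - m| := by
      have := abs_sub_le a m b
      rwa [abs_sub_comm m b] at this
    have e : (a * Real.log a - a * Real.log m - a + m) / (2 * ε)
        + (b * Real.log b - b * Real.log m - b + m) / (2 * ε)
        = (1 / 2 * (a * Real.log a) + 1 / 2 * (b * Real.log b) - m * Real.log m) / ε := by
      have h5 : a + b = 2 * m := by rw [hm]; ring
      field_simp
      linear_combination (-Real.log m - 1) * h5
    have e2 : ε * (a + m) + ε * (b + m) = 2 * ε * (a + b) := by rw [hm]; ring
    linarith

/-- Uniform convexity of the entropy in `L¹`. -/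
theorem integral_abs_sub_density_le (hμ : FiniteEntropy μ) (hν : FiniteEntropy ν) {ε : ℝ}
    (hε : 0 < ε) :
    ∫ x, |density μ x - density ν x| ≤ (1 / 2 * entropy μ + 1 / 2 * entropy ν
      - entropy (CoulombGas.mix (1 / 2) μ ν)) / ε + 4 * ε := by
  have hm := hμ.mix hν (t := 1 / 2) (by norm_num) (by norm_num)
  have := isProbabilityMeasure_mix (μ := μ) (ν := ν) (t := 1 / 2) (by norm_num) (by norm_num)
  have i₁ := ((integrable_density_mul_iff hμ.ac).2 hμ.integrable_log).const_mul (1 / 2)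
  have i₂ := ((integrable_density_mul_iff hν.ac).2 hν.integrable_log).const_mul (1 / 2)
  have i₃ := (integrable_density_mul_iff hm.ac).2 hm.integrable_log
  have j₁ : Integrable (density μ) := integrable_density
  have j₂ : Integrable (density ν) := integrable_density
  have i₄ : Integrable (fun x => 1 / 2 * (density μ x * Real.log (density μ x))
      + 1 / 2 * (density ν x * Real.log (density ν x))) := i₁.add i₂
  have i₅ : Integrable (fun x => (1 / 2 * (density μ x * Real.log (density μ x))
      + 1 / 2 * (density ν x * Real.log (density ν x))
      - density (CoulombGas.mix (1 / 2) μ ν) x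
        * Real.log (density (CoulombGas.mix (1 / 2) μ ν) x)) / ε) := (i₄.sub i₃).div_const ε
  have i₆ : Integrable (fun x => 2 * ε * (density μ x + density ν x)) :=
    (j₁.add j₂).const_mul (2 * ε)
  have e : (1 / 2 * entropy μ + 1 / 2 * entropy ν
      - entropy (CoulombGas.mix (1 / 2) μ ν)) / ε + 4 * ε
      = ∫ x, ((1 / 2 * (density μ x * Real.log (density μ x))
      + 1 / 2 * (density ν x * Real.log (density ν x))
      - density (CoulombGas.mix (1 / 2) μ ν) x
        * Real.log (density (CoulombGas.mix (1 / 2) μ ν) x)) / ε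
        + 2 * ε * (density μ x + density ν x)) := by
    rw [integral_add i₅ i₆, integral_div, integral_sub i₄ i₃, integral_add i₁ i₂,
      integral_const_mul, integral_const_mul, integral_const_mul, integral_add j₁ j₂,
      integral_density hμ.ac, integral_density hν.ac, integral_density_mul hμ.ac,
      integral_density_mul hν.ac, integral_density_mul hm.ac]
    unfold entropy
    ring
  rw [e]
  refine integral_mono_ae (j₁.sub j₂).abs (i₅.add i₆) ?_
  filter_upwards [density_mix (μ := μ) (ν := ν) (t := 1 / 2) (by norm_num) (by norm_num)]
    with x hx
  rw [hx, show (1 - 1 / 2 : ℝ) = 1 / 2 by norm_num]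
  exact abs_sub_le_entropy_gap (density_nonneg μ x) (density_nonneg ν x) hε

end mix

/-! ### Coercivity -/

/-- A continuous potential with the logarithmic lower bound `W ≥ P' ln (1 + x²) + C`. -/
structure Confining (W : ℝ → ℝ) (P' C : ℝ) : Prop where
  continuous : Continuous W
  lower : ∀ x, P' * logWeight x + C ≤ W x

theorem exp_neg_mul_logWeight (a x : ℝ) :
    Real.exp (-(a * logWeight x)) = (1 + x ^ 2) ^ (-a) := by
  rw [Real.rpow_def_of_pos (by positivity), logWeight]
  congr 1
  ring

theorem integrable_exp_neg_mul_logWeight {a : ℝ} (ha : 1 / 2 < a) :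
    Integrable (fun x => Real.exp (-(a * logWeight x))) := by
  have h := integrable_rpow_neg_one_add_norm_sq (E := ℝ) (μ := volume) (r := 2 * a)
    (by simp; linarith)
  refine h.congr (ae_of_all _ fun x => ?_)
  simp only [exp_neg_mul_logWeight, Real.norm_eq_abs, sq_abs]
  congr 1
  ring

/-- The reference mass `∫ (1 + x²)^{-3/4} dx`. Any exponent in `(1/2, 1)` serves: it is integrable,
and smaller than `P' - P` by a margin that does not depend on `P < P' - 1`. -/
def refMass : ℝ := ∫ x, Real.exp (-(3 / 4 * logWeight x))

theorem integral_logWeight_nonneg (μ : Measure ℝ) : 0 ≤ ∫ x, logWeight x ∂μ :=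
  integral_nonneg logWeight_nonneg

section coercive
variable {W : ℝ → ℝ} {P' C P : ℝ} {μ : Measure ℝ} [IsProbabilityMeasure μ]

theorem neg_log_refMass_le (h : FiniteEntropy μ) :
    -Real.log refMass ≤ entropy μ + 3 / 4 * ∫ x, logWeight x ∂μ := by
  have := (gibbs_variational h (integrable_exp_neg_mul_logWeight (a := 3 / 4) (by norm_num))
    (h.integrable_logWeight.const_mul (3 / 4))).1
  rwa [integral_const_mul] at this

theorem le_integral_potential (hW : Confining W P' C) (h : Admissible W μ) :
    P' * (∫ x, logWeight x ∂μ) + C ≤ ∫ x, W x ∂μ := by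
  have e : P' * (∫ x, logWeight x ∂μ) + C = ∫ x, (P' * logWeight x + C) ∂μ := by
    rw [integral_add (h.integrable_logWeight.const_mul P') (integrable_const _),
      integral_const_mul]
    simp
  rw [e]
  exact integral_mono ((h.integrable_logWeight.const_mul P').add (integrable_const _))
    h.integrable_potential hW.lower

theorem energy_lower_bound (hW : Confining W P' C) (hP : P ∈ Ioo 0 (P' - 1))
    (h : Admissible W μ) :
    (∫ x, logWeight x ∂μ) / 4 + C - Real.log refMass ≤ energy W P μ := by
  have h1 := le_integral_potential hW h
  have h2 := neg_log_refMass_le h.toFiniteEntropy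
  have h3 := mul_le_mul_of_nonneg_left
    (mutualLog_le h.integrable_logWeight h.toFiniteEntropy) hP.1.le
  have h4 := mul_nonneg (sub_nonneg.2 hP.2.le) (integral_logWeight_nonneg μ)
  unfold energy
  nlinarith

end coercive

/-- The uniform distribution on `[0, 1]`, which provides upper bounds for minimal energies. -/
def unif : Measure ℝ := volume.restrict (Icc 0 1)

instance : IsProbabilityMeasure unif := ⟨by simp [unif]⟩

theorem log_density_unif : ∀ᵐ x ∂unif, Real.log (density unif x) = 0 := by
  have h := Measure.rnDeriv_restrict_self (volume : Measure ℝ) (measurableSet_Icc (a := 0) (b := 1))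
  filter_upwards [ae_restrict_of_ae h, ae_restrict_mem measurableSet_Icc] with x hx hx1
  rw [density, unif, hx, indicator_of_mem hx1]
  simp

theorem finiteEntropy_unif : FiniteEntropy unif where
  ac := Measure.absolutelyContinuous_of_le Measure.restrict_le_self
  integrable_log := (integrable_zero ℝ ℝ unif).congr
    (log_density_unif.mono fun _ hx => hx.symm)
  integrable_logWeight := continuous_logWeight.integrableOn_Icc

theorem entropy_unif : entropy unif = 0 := by
  rw [entropy, integral_congr_ae log_density_unif]
  simp

theorem admissible_unif {W : ℝ → ℝ} (hW : Continuous W) : Admissible W unif :=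
  ⟨finiteEntropy_unif, hW.integrableOn_Icc⟩

/-! ### Existence of a minimizer -/

/-- The densities of a sequence of measures that is Cauchy in `L¹` converge, along a subsequence
and almost everywhere, to the density of a probability measure. -/
theorem exists_tendsto_density {μ : ℕ → Measure ℝ} (hprob : ∀ n, IsProbabilityMeasure (μ n))
    (hac : ∀ n, μ n ≪ volume)
    (hcauchy : ∀ ε > 0, ∃ N, ∀ n ≥ N, ∀ k ≥ N, ∫ x, |density (μ n) x - density (μ k) x| < ε) :
    ∃ ν : Measure ℝ, IsProbabilityMeasure ν ∧ ν ≪ volume ∧ ∃ φ : ℕ → ℕ, StrictMono φ ∧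
      ∀ᵐ x, Tendsto (fun k => density (μ (φ k)) x) atTop (𝓝 (density ν x)) := by
  have hi : ∀ n, Integrable (density (μ n)) := fun n => integrable_density
  set u : ℕ → (ℝ →₁[volume] ℝ) := fun n => (hi n).toL1 _ with hu
  have hc : CauchySeq u := by
    refine Metric.cauchySeq_iff.2 fun ε hε => ?_
    obtain ⟨N, hN⟩ := hcauchy ε hε
    refine ⟨N, fun n hn k hk => ?_⟩
    rw [dist_eq_norm, hu, ← Integrable.toL1_sub, L1.norm_of_fun_eq_integral_norm]
    exact hN n hn k hk
  obtain ⟨f, hf⟩ := cauchySeq_tendsto_of_complete hc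
  obtain ⟨φ, hφ, hae⟩ := (tendstoInMeasure_of_tendsto_Lp hf).exists_seq_tendsto_ae
  have hlim : ∀ᵐ x, Tendsto (fun k => density (μ (φ k)) x) atTop (𝓝 (f x)) := by
    have h2 : ∀ᵐ x, ∀ k, u (φ k) x = density (μ (φ k)) x :=
      ae_all_iff.2 fun k => (hi (φ k)).coeFn_toL1
    filter_upwards [hae, h2] with x h1 h2
    simpa only [h2] using h1
  have hf0 : ∀ᵐ x, 0 ≤ f x := hlim.mono fun x hx =>
    ge_of_tendsto' hx fun k => density_nonneg _ _
  have hint : ∫ x, f x = 1 := by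
    have h1 := (continuous_integral.tendsto f).comp hf
    have h2 : ∀ n, ((fun f : ℝ →₁[volume] ℝ => ∫ x, f x) ∘ u) n = 1 := fun n => by
      simp only [Function.comp_apply, hu]
      rw [integral_congr_ae (hi n).coeFn_toL1, integral_density (hac n)]
    exact tendsto_nhds_unique h1 (by simp only [funext h2]; exact tendsto_const_nhds)
  have hfm : Measurable f := L1.measurable_coeFn f
  have hfi : Integrable f := L1.integrable_coeFn f
  refine ⟨volume.withDensity fun x => ENNReal.ofReal (f x), ⟨?_⟩,
    withDensity_absolutelyContinuous _ _, φ, hφ, ?_⟩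
  · rw [withDensity_apply _ MeasurableSet.univ, Measure.restrict_univ,
      ← ofReal_integral_eq_lintegral_ofReal hfi hf0, hint, ENNReal.ofReal_one]
  · filter_upwards [hlim, hf0, Measure.rnDeriv_withDensity volume hfm.ennreal_ofReal]
      with x h1 h2 h3
    rwa [density, h3, ENNReal.toReal_ofReal h2]

theorem lintegral_prod_density {μ : Measure ℝ} [IsProbabilityMeasure μ] (hac : μ ≪ volume)
    {h : ℝ × ℝ → ℝ≥0∞} (hm : Measurable h) :
    ∫⁻ z, h z ∂(μ.prod μ) = ∫⁻ z : ℝ × ℝ,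
      ENNReal.ofReal (density μ z.1) * ENNReal.ofReal (density μ z.2) * h z := by
  have hd : Measurable fun x => ENNReal.ofReal (density μ x) :=
    (measurable_density μ).ennreal_ofReal
  have hd2 : Measurable fun z : ℝ × ℝ =>
      ENNReal.ofReal (density μ z.1) * ENNReal.ofReal (density μ z.2) :=
    (hd.comp measurable_fst).mul (hd.comp measurable_snd)
  conv_lhs => rw [← withDensity_density hac]
  rw [prod_withDensity hd hd, lintegral_withDensity_eq_lintegral_mul _ hd2 hm]
  rfl

/-- Fatou's lemma for interaction energies. -/
theorem lintegral_prod_le_liminf {μ : ℕ → Measure ℝ} {ν : Measure ℝ}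
    (hprob : ∀ n, IsProbabilityMeasure (μ n)) [IsProbabilityMeasure ν]
    (hac : ∀ n, μ n ≪ volume) (hν : ν ≪ volume)
    (hlim : ∀ᵐ x, Tendsto (fun k => density (μ k) x) atTop (𝓝 (density ν x)))
    {h : ℝ × ℝ → ℝ} (hm : Measurable h) :
    ∫⁻ z, ENNReal.ofReal (h z) ∂(ν.prod ν)
      ≤ liminf (fun k => ∫⁻ z, ENNReal.ofReal (h z) ∂((μ k).prod (μ k))) atTop := by
  rw [lintegral_prod_density hν hm.ennreal_ofReal]
  simp_rw [fun k => lintegral_prod_density (hac k) hm.ennreal_ofReal]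
  refine le_trans (lintegral_mono_ae ?_) (lintegral_liminf_le fun k => ?_)
  · have h1 := (Measure.quasiMeasurePreserving_fst (μ := (volume : Measure ℝ))
      (ν := (volume : Measure ℝ))).ae hlim
    have h2 := (Measure.quasiMeasurePreserving_snd (μ := (volume : Measure ℝ))
      (ν := (volume : Measure ℝ))).ae hlim
    rw [Measure.volume_eq_prod]
    filter_upwards [h1, h2] with z h1 h2
    refine (Tendsto.liminf_eq ?_).ge
    refine ENNReal.Tendsto.mul_const (ENNReal.Tendsto.mul (ENNReal.tendsto_ofReal h1)
      (Or.inr ENNReal.ofReal_ne_top) (ENNReal.tendsto_ofReal h2) (Or.inr ENNReal.ofReal_ne_top))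
      (Or.inr ENNReal.ofReal_ne_top)
  · have hd : Measurable fun x => ENNReal.ofReal (density (μ k) x) :=
      (measurable_density (μ k)).ennreal_ofReal
    exact ((hd.comp measurable_fst).mul (hd.comp measurable_snd)).mul hm.ennreal_ofReal

theorem liminf_add_liminf_le (u v : ℕ → ℝ≥0∞) :
    liminf u atTop + liminf v atTop ≤ liminf (fun k => u k + v k) atTop := by
  rw [liminf_eq_iSup_iInf_of_nat, liminf_eq_iSup_iInf_of_nat, liminf_eq_iSup_iInf_of_nat,
    ENNReal.iSup_add_iSup_of_monotone]
  · gcongr with n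
    exact le_iInf₂ fun i hi => add_le_add (iInf₂_le i hi) (iInf₂_le i hi)
  · exact fun a b hab => biInf_mono fun i hi => le_trans hab hi
  · exact fun a b hab => biInf_mono fun i hi => le_trans hab hi

/-- The density of the entropy relative to the reference weight `(1 + x²)^{-3/4}`, normalized so
that it is nonnegative. -/
def relEntropyDensity (μ : Measure ℝ) (x : ℝ) : ℝ :=
  density μ x * Real.log (density μ x) - density μ x + Real.exp (-(3 / 4 * logWeight x))
    + density μ x * (3 / 4 * logWeight x)

/-- What remains of the interaction energy when the reference weight and the constant `C` are taken
out. -/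
def interaction (W : ℝ → ℝ) (P C : ℝ) (z : ℝ × ℝ) : ℝ :=
  (W z.1 + W z.2) / 2 - P * Real.log |z.1 - z.2| - 3 / 8 * (logWeight z.1 + logWeight z.2) - C

theorem relEntropyDensity_nonneg (μ : Measure ℝ) (x : ℝ) : 0 ≤ relEntropyDensity μ x := by
  have := mul_le_mul_log_add_exp (density_nonneg μ x) (-(3 / 4 * logWeight x))
  unfold relEntropyDensity
  linarith

theorem measurable_relEntropyDensity (μ : Measure ℝ) : Measurable (relEntropyDensity μ) := by
  have h1 := measurable_density μ
  have h2 := continuous_logWeight.measurable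
  unfold relEntropyDensity
  fun_prop

section semicontinuity
variable {W : ℝ → ℝ} {P' C P : ℝ}

theorem measurable_interaction (hW : Measurable W) : Measurable (interaction W P C) := by
  have h2 := continuous_logWeight.measurable
  unfold interaction
  fun_prop

theorem le_interaction (hW : Confining W P' C) (hP : P ∈ Ioo 0 (P' - 1)) (z : ℝ × ℝ) :
    (logWeight z.1 + logWeight z.2) / 8 ≤ interaction W P C z := by
  have h1 := mul_le_mul_of_nonneg_left (two_log_abs_sub_le z.1 z.2) hP.1.le
  have h2 := mul_nonneg (sub_nonneg.2 hP.2.le)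
    (add_nonneg (logWeight_nonneg z.1) (logWeight_nonneg z.2))
  unfold interaction
  nlinarith [hW.lower z.1, hW.lower z.2]

theorem interaction_nonneg (hW : Confining W P' C) (hP : P ∈ Ioo 0 (P' - 1)) (z : ℝ × ℝ) :
    0 ≤ interaction W P C z := by
  have := le_interaction hW hP z
  linarith [logWeight_nonneg z.1, logWeight_nonneg z.2]

variable {μ : Measure ℝ} [IsProbabilityMeasure μ]

theorem lintegral_relEntropyDensity (h : FiniteEntropy μ) :
    0 ≤ entropy μ - 1 + refMass + 3 / 4 * (∫ x, logWeight x ∂μ) ∧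
    ∫⁻ x, ENNReal.ofReal (relEntropyDensity μ x)
      = ENNReal.ofReal (entropy μ - 1 + refMass + 3 / 4 * ∫ x, logWeight x ∂μ) := by
  have i₁ := (integrable_density_mul_iff h.ac).2 h.integrable_log
  have i₂ : Integrable (density μ) := integrable_density
  have i₃ := integrable_exp_neg_mul_logWeight (a := 3 / 4) (by norm_num)
  have i₄ := (integrable_density_mul_iff h.ac).2 (h.integrable_logWeight.const_mul (3 / 4))
  have i₅ : Integrable (fun x => density μ x * Real.log (density μ x) - density μ x) := i₁.sub i₂
  have i₆ : Integrable (fun x => density μ x * Real.log (density μ x) - density μ x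
    + Real.exp (-(3 / 4 * logWeight x))) := i₅.add i₃
  have i₇ : Integrable (relEntropyDensity μ) := i₆.add i₄
  have e : ∫ x, relEntropyDensity μ x
      = entropy μ - 1 + refMass + 3 / 4 * ∫ x, logWeight x ∂μ := by
    unfold relEntropyDensity
    rw [integral_add i₆ i₄, integral_add i₅ i₃, integral_sub i₁ i₂, integral_density h.ac,
      integral_density_mul h.ac, integral_density_mul h.ac, integral_const_mul, entropy, refMass]
  rw [← e, ofReal_integral_eq_lintegral_ofReal i₇ (ae_of_all _ (relEntropyDensity_nonneg μ))]
  exact ⟨integral_nonneg (relEntropyDensity_nonneg μ), rfl⟩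

theorem lintegral_interaction (hW : Confining W P' C) (hP : P ∈ Ioo 0 (P' - 1))
    (h : Admissible W μ) :
    0 ≤ (∫ x, W x ∂μ) - P * mutualLog μ μ - 3 / 4 * (∫ x, logWeight x ∂μ) - C ∧
    ∫⁻ z, ENNReal.ofReal (interaction W P C z) ∂(μ.prod μ)
      = ENNReal.ofReal
        ((∫ x, W x ∂μ) - P * mutualLog μ μ - 3 / 4 * (∫ x, logWeight x ∂μ) - C) := by
  have i₁ := h.integrable_potential.comp_fst μ
  have i₂ := h.integrable_potential.comp_snd μ
  have i₃ := (finiteMutualLog h.integrable_logWeight h.toFiniteEntropy).2.const_mul P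
  have i₄ := h.integrable_logWeight.comp_fst μ
  have i₅ := h.integrable_logWeight.comp_snd μ
  have i₆ : Integrable (fun z : ℝ × ℝ => (W z.1 + W z.2) / 2) (μ.prod μ) :=
    (i₁.add i₂).div_const 2
  have i₇ : Integrable (fun z : ℝ × ℝ => (W z.1 + W z.2) / 2 - P * Real.log |z.1 - z.2|)
    (μ.prod μ) := i₆.sub i₃
  have i₈ : Integrable (fun z : ℝ × ℝ => 3 / 8 * (logWeight z.1 + logWeight z.2)) (μ.prod μ) :=
    (i₄.add i₅).const_mul (3 / 8)
  have i₉ : Integrable (fun z : ℝ × ℝ => (W z.1 + W z.2) / 2 - P * Real.log |z.1 - z.2|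
    - 3 / 8 * (logWeight z.1 + logWeight z.2)) (μ.prod μ) := i₇.sub i₈
  have i₀ : Integrable (interaction W P C) (μ.prod μ) := i₉.sub (integrable_const C)
  have e : ∫ z, interaction W P C z ∂(μ.prod μ)
      = (∫ x, W x ∂μ) - P * mutualLog μ μ - 3 / 4 * (∫ x, logWeight x ∂μ) - C := by
    unfold interaction
    rw [integral_sub i₉ (integrable_const C), integral_sub i₇ i₈, integral_sub i₆ i₃,
      integral_div, integral_add i₁ i₂, integral_const_mul, integral_const_mul,
      integral_add i₄ i₅, integral_fun_fst, integral_fun_snd, integral_fun_fst (f := logWeight),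
      integral_fun_snd (f := logWeight), mutualLog]
    simp
    ring
  rw [← e, ofReal_integral_eq_lintegral_ofReal i₀ (ae_of_all _ (interaction_nonneg hW hP))]
  exact ⟨integral_nonneg (interaction_nonneg hW hP), rfl⟩

/-- A measure whose relative entropy and interaction energy are finite is admissible. -/
theorem admissible_of_lintegral_lt_top (hW : Confining W P' C) (hP : P ∈ Ioo 0 (P' - 1))
    (hac : μ ≪ volume) (hA : ∫⁻ x, ENNReal.ofReal (relEntropyDensity μ x) < ∞)
    (hB : ∫⁻ z, ENNReal.ofReal (interaction W P C z) ∂(μ.prod μ) < ∞) : Admissible W μ := by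
  have iA : Integrable (relEntropyDensity μ) := by
    refine ⟨(measurable_relEntropyDensity μ).aestronglyMeasurable, ?_⟩
    rwa [HasFiniteIntegral, lintegral_congr fun x =>
      Real.enorm_eq_ofReal (relEntropyDensity_nonneg μ x)]
  have iB : Integrable (interaction W P C) (μ.prod μ) := by
    refine ⟨(measurable_interaction hW.continuous.measurable).aestronglyMeasurable, ?_⟩
    rwa [HasFiniteIntegral, lintegral_congr fun x =>
      Real.enorm_eq_ofReal (interaction_nonneg hW hP x)]
  have hl : Integrable logWeight μ := by
    have : Integrable (fun z : ℝ × ℝ => logWeight z.1) (μ.prod μ) := by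
      refine (iB.const_mul 8).mono'
        (continuous_logWeight.comp continuous_fst).aestronglyMeasurable (ae_of_all _ fun z => ?_)
      rw [Real.norm_of_nonneg (logWeight_nonneg _)]
      linarith [le_interaction hW hP z, logWeight_nonneg z.2]
    simpa using this.integral_prod_left
  have hfe : FiniteEntropy μ := by
    refine ⟨hac, (integrable_density_mul_iff hac).1 ?_, hl⟩
    have i₂ : Integrable (density μ) := integrable_density
    have i₃ := integrable_exp_neg_mul_logWeight (a := 3 / 4) (by norm_num)
    have i₄ := (integrable_density_mul_iff hac).2 (hl.const_mul (3 / 4))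
    refine (((iA.sub i₃).add i₂).sub i₄).congr (ae_of_all _ fun x => ?_)
    simp only [Pi.add_apply, Pi.sub_apply, relEntropyDensity]
    ring
  have hlog := (finiteMutualLog hl hfe).2
  refine Admissible.of_freeEnergy_ne_top (P := P) hW.continuous.measurable hP.1
    (by linarith [hP.2]) hW.lower ?_
  have iK : Integrable (fun z : ℝ × ℝ => W z.1 + W z.2 - 2 * P * Real.log |z.1 - z.2|)
      (μ.prod μ) := by
    refine (((iB.const_mul 2).add (((hl.comp_fst μ).add (hl.comp_snd μ)).const_mul (3 / 4))).add
      (integrable_const (2 * C))).congr (ae_of_all _ fun z => ?_)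
    simp only [Pi.add_apply, interaction]
    ring
  rw [freeEnergy, if_pos ⟨hac, hfe.integrable_log⟩, extIntegral_of_integrable iK,
    ← EReal.coe_mul, ← EReal.coe_add]
  exact EReal.coe_ne_top _

/-- Lower semicontinuity of the free energy under almost everywhere convergence of densities. -/
theorem energy_le_of_tendsto (hW : Confining W P' C) (hP : P ∈ Ioo 0 (P' - 1))
    {ν : ℕ → Measure ℝ} (hprob : ∀ n, IsProbabilityMeasure (ν n))
    (hν : ∀ n, Admissible W (ν n)) (hac : μ ≪ volume)
    (hlim : ∀ᵐ x, Tendsto (fun k => density (ν k) x) atTop (𝓝 (density μ x))) {m : ℝ}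
    (hm : Tendsto (fun k => energy W P (ν k)) atTop (𝓝 m)) :
    Admissible W μ ∧ energy W P μ ≤ m := by
  have hA : ∫⁻ x, ENNReal.ofReal (relEntropyDensity μ x)
      ≤ liminf (fun k => ∫⁻ x, ENNReal.ofReal (relEntropyDensity (ν k) x)) atTop := by
    refine le_trans (lintegral_mono_ae ?_)
      (lintegral_liminf_le fun k => (measurable_relEntropyDensity (ν k)).ennreal_ofReal)
    filter_upwards [hlim] with x hx
    refine (Tendsto.liminf_eq (ENNReal.tendsto_ofReal ?_)).ge
    have h1 := (Real.continuous_mul_log.tendsto (density μ x)).comp hx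
    exact ((h1.sub hx).add_const _).add (hx.mul_const _)
  have hB := lintegral_prod_le_liminf hprob (fun n => (hν n).ac) hac hlim
    (measurable_interaction (P := P) (C := C) hW.continuous.measurable)
  have hsum : ∀ k, (∫⁻ x, ENNReal.ofReal (relEntropyDensity (ν k) x))
      + ∫⁻ z, ENNReal.ofReal (interaction W P C z) ∂((ν k).prod (ν k))
      = ENNReal.ofReal (energy W P (ν k) - C - 1 + refMass) := fun k => by
    obtain ⟨h1, e1⟩ := lintegral_relEntropyDensity (hν k).toFiniteEntropy
    obtain ⟨h2, e2⟩ := lintegral_interaction hW hP (hν k)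
    rw [e1, e2, ← ENNReal.ofReal_add h1 h2, energy]
    congr 1
    ring
  have hpos : ∀ k, 0 ≤ energy W P (ν k) - C - 1 + refMass := fun k => by
    have h1 := (lintegral_relEntropyDensity (hν k).toFiniteEntropy).1
    have h2 := (lintegral_interaction hW hP (hν k)).1
    unfold energy
    linarith
  have hlimE : Tendsto (fun k => energy W P (ν k) - C - 1 + refMass) atTop
      (𝓝 (m - C - 1 + refMass)) := ((hm.sub_const C).sub_const 1).add_const refMass
  have hm0 : 0 ≤ m - C - 1 + refMass := ge_of_tendsto' hlimE hpos
  have key : (∫⁻ x, ENNReal.ofReal (relEntropyDensity μ x))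
      + ∫⁻ z, ENNReal.ofReal (interaction W P C z) ∂(μ.prod μ)
      ≤ ENNReal.ofReal (m - C - 1 + refMass) := by
    refine (add_le_add hA hB).trans ((liminf_add_liminf_le _ _).trans_eq ?_)
    simp_rw [hsum]
    exact (ENNReal.tendsto_ofReal hlimE).liminf_eq
  have hμ : Admissible W μ := admissible_of_lintegral_lt_top hW hP hac
    ((le_self_add.trans key).trans_lt ENNReal.ofReal_lt_top)
    ((le_add_self.trans key).trans_lt ENNReal.ofReal_lt_top)
  refine ⟨hμ, ?_⟩
  obtain ⟨h1, e1⟩ := lintegral_relEntropyDensity hμ.toFiniteEntropy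
  obtain ⟨h2, e2⟩ := lintegral_interaction hW hP hμ
  rw [e1, e2, ← ENNReal.ofReal_add h1 h2, ENNReal.ofReal_le_ofReal_iff hm0] at key
  unfold energy
  linarith

theorem exists_minimizer (hW : Confining W P' C) (hP : P ∈ Ioo 0 (P' - 1)) :
    ∃ μ : Measure ℝ, IsProbabilityMeasure μ ∧ Admissible W μ ∧
      ∀ ν : Measure ℝ, IsProbabilityMeasure ν → Admissible W ν →
        energy W P μ ≤ energy W P ν := by
  set S : Set ℝ := {e | ∃ ν : Measure ℝ, IsProbabilityMeasure ν ∧ Admissible W ν ∧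
    energy W P ν = e} with hS
  have hne : S.Nonempty := ⟨_, unif, inferInstance, admissible_unif hW.continuous, rfl⟩
  have hbdd : BddBelow S := by
    refine ⟨C - Real.log refMass, ?_⟩
    rintro _ ⟨ν, hν, hadm, rfl⟩
    have := energy_lower_bound hW hP hadm
    linarith [integral_logWeight_nonneg ν]
  obtain ⟨e, -, he, heS⟩ := exists_seq_tendsto_sInf hne hbdd
  choose ν hprob hadm hen using heS
  have hle : ∀ ξ : Measure ℝ, IsProbabilityMeasure ξ → Admissible W ξ →
      sInf S ≤ energy W P ξ := fun ξ h1 h2 => csInf_le hbdd ⟨ξ, h1, h2, rfl⟩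
  have hcauchy : ∀ ε > 0, ∃ N, ∀ n ≥ N, ∀ k ≥ N,
      ∫ x, |density (ν n) x - density (ν k) x| < ε := by
    intro ε hε
    -- the entropy gap at the midpoint is at most the excess of the energies over the infimum
    obtain ⟨N, hN⟩ := eventually_atTop.1 (he.eventually_lt_const
      (lt_add_of_pos_right (sInf S) (by positivity : 0 < ε ^ 2 / 32)))
    refine ⟨N, fun n hn k hk => ?_⟩
    have h1 := integral_abs_sub_density_le (hadm n).toFiniteEntropy (hadm k).toFiniteEntropy
      (ε := ε / 8) (by positivity)
    have h2 := energy_mix (hadm n) (hadm k) (t := 1 / 2) (by norm_num) (by norm_num) P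
    have h3 := isProbabilityMeasure_mix (μ := ν n) (ν := ν k) (t := 1 / 2)
      (by norm_num) (by norm_num)
    have h4 := hle _ h3 ((hadm n).mix (hadm k) (t := 1 / 2) (by norm_num) (by norm_num))
    have h5 := mul_nonneg hP.1.le
      (logEnergyDiff_nonneg (hadm n).toFiniteEntropy (hadm k).toFiniteEntropy)
    have h6 := hN n hn
    have h7 := hN k hk
    rw [← hen n] at h6
    rw [← hen k] at h7
    have h8 : 1 / 2 * entropy (ν n) + 1 / 2 * entropy (ν k)
        - entropy (mix (1 / 2) (ν n) (ν k)) < ε ^ 2 / 32 := by linarith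
    have h9 : (1 / 2 * entropy (ν n) + 1 / 2 * entropy (ν k)
        - entropy (mix (1 / 2) (ν n) (ν k))) / (ε / 8) < ε / 4 := by
      rw [div_lt_iff₀ (by positivity)]
      linarith
    linarith
  obtain ⟨μ, hμ, hac, φ, hφ, hlim⟩ :=
    exists_tendsto_density hprob (fun n => (hadm n).ac) hcauchy
  have hlimE : Tendsto (fun k => energy W P (ν (φ k))) atTop (𝓝 (sInf S)) := by
    simp_rw [hen]
    exact he.comp hφ.tendsto_atTop
  obtain ⟨h1, h2⟩ := energy_le_of_tendsto hW hP (fun n => hprob (φ n)) (fun n => hadm (φ n))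
    hac hlim hlimE
  exact ⟨μ, hμ, h1, fun ξ h3 h4 => h2.trans (hle ξ h3 h4)⟩

end semicontinuity

/-! ### Gibbs measures -/

/-- The Gibbs measure with density `e^{-T} / ∫ e^{-T}`. -/
def gibbs (T : ℝ → ℝ) : Measure ℝ :=
  volume.withDensity fun x => ENNReal.ofReal (Real.exp (-T x) / ∫ y, Real.exp (-T y))

theorem le_four_mul_exp_div_four (s : ℝ) : s ≤ 4 * Real.exp (s / 4) := by
  linarith [Real.add_one_le_exp (s / 4)]

section gibbs
variable {T : ℝ → ℝ} {k : ℝ}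

theorem integrable_exp_neg (hm : Measurable T) (hT : ∀ x, logWeight x - k ≤ T x) :
    Integrable (fun x => Real.exp (-T x)) := by
  refine ((integrable_exp_neg_mul_logWeight (a := 1) (by norm_num)).const_mul (Real.exp k)).mono'
    hm.neg.exp.aestronglyMeasurable (ae_of_all _ fun x => ?_)
  rw [Real.norm_of_nonneg (Real.exp_pos _).le, ← Real.exp_add]
  exact Real.exp_le_exp.2 (by linarith [hT x])

theorem density_gibbs (hm : Measurable T) (hT : ∀ x, logWeight x - k ≤ T x) :
    ∀ᵐ x, density (gibbs T) x = Real.exp (-T x) / ∫ y, Real.exp (-T y) := by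
  have hZ := integral_exp_pos (integrable_exp_neg hm hT)
  filter_upwards [Measure.rnDeriv_withDensity volume
    (f := fun x => ENNReal.ofReal (Real.exp (-T x) / ∫ y, Real.exp (-T y)))
    (hm.neg.exp.div_const _).ennreal_ofReal] with x hx
  rw [density, gibbs, hx, ENNReal.toReal_ofReal (div_nonneg (Real.exp_pos _).le hZ.le)]

theorem isProbabilityMeasure_gibbs (hm : Measurable T) (hT : ∀ x, logWeight x - k ≤ T x) :
    IsProbabilityMeasure (gibbs T) := by
  have hi := integrable_exp_neg hm hT
  have hZ := integral_exp_pos hi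
  constructor
  rw [gibbs, withDensity_apply _ MeasurableSet.univ, Measure.restrict_univ,
    ← ofReal_integral_eq_lintegral_ofReal (hi.div_const _)
      (ae_of_all _ fun x => div_nonneg (Real.exp_pos _).le hZ.le), integral_div,
    div_self hZ.ne', ENNReal.ofReal_one]

theorem gibbs_ac : gibbs T ≪ volume := withDensity_absolutelyContinuous _ _

/-- Functions that grow at most like the potential `T` itself are integrable for its Gibbs
measure. -/
theorem integrable_gibbs (hm : Measurable T) (hT : ∀ x, logWeight x - k ≤ T x) {f : ℝ → ℝ}
    (hf : Measurable f) {c : ℝ} (hfb : ∀ x, |f x| ≤ c + (T x + k)) : Integrable f (gibbs T) := by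
  have := isProbabilityMeasure_gibbs hm hT
  have hZ := integral_exp_pos (integrable_exp_neg hm hT)
  rw [← integrable_density_mul_iff gibbs_ac]
  refine (((integrable_exp_neg_mul_logWeight (a := 3 / 4) (by norm_num)).const_mul
    (Real.exp k * (|c| + 4))).div_const (∫ y, Real.exp (-T y))).mono'
    ((measurable_density _).mul hf).aestronglyMeasurable ?_
  filter_upwards [density_gibbs hm hT] with x hx
  rw [hx, norm_mul, Real.norm_of_nonneg (div_nonneg (Real.exp_pos _).le hZ.le),
    div_mul_eq_mul_div, Real.norm_eq_abs]
  refine div_le_div_of_nonneg_right ?_ hZ.le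
  -- with `s = T + k ≥ logWeight ≥ 0`, the factor `c + s` is absorbed by `e^{s/4}`
  set s := T x + k with hs
  have hls : logWeight x ≤ s := by linarith [hT x]
  have hs0 : 0 ≤ s := (logWeight_nonneg x).trans hls
  have h1 : c + s ≤ (|c| + 4) * Real.exp (s / 4) := by
    have h2 := le_four_mul_exp_div_four s
    have h3 : (1 : ℝ) ≤ Real.exp (s / 4) := Real.one_le_exp (by positivity)
    nlinarith [le_abs_self c, abs_nonneg c]
  calc Real.exp (-T x) * |f x| ≤ Real.exp (-T x) * ((|c| + 4) * Real.exp (s / 4)) := by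
        gcongr; exact (hfb x).trans h1
    _ = Real.exp k * (|c| + 4) * Real.exp (-(3 / 4 * s)) := by
        rw [show -T x = k + (-(3 / 4 * s) - s / 4) by rw [hs]; ring, Real.exp_add, Real.exp_sub]
        field_simp
    _ ≤ Real.exp k * (|c| + 4) * Real.exp (-(3 / 4 * logWeight x)) := by
        gcongr

theorem integrable_gibbs_self (hm : Measurable T) (hT : ∀ x, logWeight x - k ≤ T x) :
    Integrable T (gibbs T) := by
  refine integrable_gibbs hm hT hm (c := |k|) fun x => abs_le.2 ⟨?_, ?_⟩
  · linarith [hT x, logWeight_nonneg x, neg_abs_le k, le_abs_self k]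
  · linarith [neg_abs_le k]

theorem log_density_gibbs (hm : Measurable T) (hT : ∀ x, logWeight x - k ≤ T x) :
    ∀ᵐ x ∂(gibbs T), Real.log (density (gibbs T) x)
      = -T x - Real.log (∫ y, Real.exp (-T y)) := by
  have hZ := integral_exp_pos (integrable_exp_neg hm hT)
  filter_upwards [gibbs_ac.ae_le (density_gibbs hm hT)] with x hx
  rw [hx, Real.log_div (Real.exp_pos _).ne' hZ.ne', Real.log_exp]

theorem finiteEntropy_gibbs (hm : Measurable T) (hT : ∀ x, logWeight x - k ≤ T x) :
    FiniteEntropy (gibbs T) where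
  ac := gibbs_ac
  integrable_log := by
    have := isProbabilityMeasure_gibbs hm hT
    exact ((integrable_gibbs_self hm hT).neg.sub (integrable_const _)).congr
      ((log_density_gibbs hm hT).mono fun x hx => hx.symm)
  integrable_logWeight := by
    refine integrable_gibbs hm hT continuous_logWeight.measurable (c := 0) fun x => ?_
    rw [abs_of_nonneg (logWeight_nonneg x)]
    linarith [hT x]

theorem entropy_gibbs_add (hm : Measurable T) (hT : ∀ x, logWeight x - k ≤ T x) :
    entropy (gibbs T) + ∫ x, T x ∂(gibbs T) = -Real.log (∫ y, Real.exp (-T y)) := by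
  have := isProbabilityMeasure_gibbs hm hT
  have hi := integrable_gibbs_self hm hT
  have hi' : Integrable (fun x => -T x) (gibbs T) := hi.neg
  rw [entropy, integral_congr_ae (log_density_gibbs hm hT),
    integral_sub hi' (integrable_const _), integral_neg]
  simp
  ring

end gibbs

/-! ### The Euler–Lagrange equation -/

/-- A probability measure of least free energy among the admissible ones. -/
structure IsMinimizer (W : ℝ → ℝ) (P : ℝ) (μ : Measure ℝ) : Prop where
  admissible : Admissible W μ
  le : ∀ ν : Measure ℝ, IsProbabilityMeasure ν → Admissible W ν → energy W P μ ≤ energy W P ν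

/-- The effective potential `W - 2 P ∫ ln |· - y| dμ(y)` of a particle in the field of `μ`. -/
def effPotential (W : ℝ → ℝ) (P : ℝ) (μ : Measure ℝ) (x : ℝ) : ℝ :=
  W x - 2 * P * logPotential μ x

section eulerLagrange
variable {W : ℝ → ℝ} {P' C P : ℝ} {μ ν : Measure ℝ} [IsProbabilityMeasure μ]
  [IsProbabilityMeasure ν]

theorem measurable_effPotential (hW : Measurable W) : Measurable (effPotential W P μ) :=
  hW.sub (measurable_logPotential.const_mul _)

theorem le_effPotential (hW : Confining W P' C) (hP : P ∈ Ioo 0 (P' - 1))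
    (hμ : FiniteEntropy μ) (x : ℝ) :
    (P' - P) * logWeight x - (P * (∫ y, logWeight y ∂μ) - C) ≤ effPotential W P μ x := by
  have h1 := mul_le_mul_of_nonneg_left (logPotential_le hμ x) hP.1.le
  unfold effPotential
  linarith [hW.lower x]

theorem logWeight_sub_le_effPotential (hW : Confining W P' C) (hP : P ∈ Ioo 0 (P' - 1))
    (hμ : FiniteEntropy μ) (x : ℝ) :
    logWeight x - (P * (∫ y, logWeight y ∂μ) - C) ≤ effPotential W P μ x := by
  have h1 := le_effPotential hW hP hμ x
  have h2 := mul_nonneg (by linarith [hP.2] : 0 ≤ P' - P - 1) (logWeight_nonneg x)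
  linarith

theorem integrable_effPotential (hμ : FiniteEntropy μ) (hν : Admissible W ν) :
    Integrable (effPotential W P μ) ν ∧
    ∫ x, effPotential W P μ x ∂ν = (∫ x, W x ∂ν) - 2 * P * mutualLog ν μ := by
  obtain ⟨hi, he⟩ := mutualLog_eq_integral_logPotential hν.integrable_logWeight hμ
  refine ⟨hν.integrable_potential.sub (hi.const_mul _), ?_⟩
  unfold effPotential
  rw [integral_sub hν.integrable_potential (hi.const_mul _), integral_const_mul, he]

/-- A minimizer also minimizes the free energy linearized in the interaction. -/
theorem IsMinimizer.linearized_le (hP : 0 < P) (hμ : IsMinimizer W P μ) (hν : Admissible W ν) :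
    entropy μ + ∫ x, effPotential W P μ x ∂μ ≤ entropy ν + ∫ x, effPotential W P μ x ∂ν := by
  rw [(integrable_effPotential hμ.admissible.toFiniteEntropy hμ.admissible).2,
    (integrable_effPotential hμ.admissible.toFiniteEntropy hν).2]
  have hd := mul_nonneg hP.le
    (logEnergyDiff_nonneg hν.toFiniteEntropy hμ.admissible.toFiniteEntropy)
  -- moving a fraction `t` of the mass from `μ` to `ν` does not lower the energy; then `t → 0`
  have h1 : ∀ t : ℝ, 0 < t → t < 1 → energy W P μ
      ≤ energy W P ν - (1 - t) * (P * logEnergyDiff ν μ) := by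
    intro t ht0 ht1
    have h2 := energy_mix hν hμ.admissible ht0 ht1 P
    have h3 := hμ.le _ (isProbabilityMeasure_mix (μ := ν) (ν := μ) ht0.le ht1.le)
      (hν.mix hμ.admissible ht0 ht1)
    have h4 := entropy_mix_le hν.toFiniteEntropy hμ.admissible.toFiniteEntropy ht0 ht1
    have h5 : t * energy W P μ ≤ t * (energy W P ν - (1 - t) * (P * logEnergyDiff ν μ)) := by
      linarith
    exact le_of_mul_le_mul_left h5 ht0
  have h2 : energy W P μ ≤ energy W P ν - P * logEnergyDiff ν μ := by
    set c := P * logEnergyDiff ν μ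
    have hlim : Tendsto (fun t : ℝ => energy W P ν - (1 - t) * c) (𝓝[>] 0)
        (𝓝 (energy W P ν - (1 - 0) * c)) :=
      (Continuous.tendsto (by fun_prop) 0).mono_left nhdsWithin_le_nhds
    have := ge_of_tendsto hlim (b := energy W P μ) (by
      filter_upwards [Ioo_mem_nhdsGT (zero_lt_one (α := ℝ))] with t ht using h1 t ht.1 ht.2)
    linarith
  unfold energy logEnergyDiff at h2
  rw [mutualLog_comm μ ν] at h2
  linarith

/-- The Euler–Lagrange equation in integrated form: a minimizer is the Gibbs measure of its own
effective potential. -/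
theorem IsMinimizer.density_eq (hW : Confining W P' C) (hP : P ∈ Ioo 0 (P' - 1))
    (hμ : IsMinimizer W P μ) :
    ∀ᵐ x, density μ x
      = Real.exp (-effPotential W P μ x) / ∫ y, Real.exp (-effPotential W P μ y) := by
  have hfe := hμ.admissible.toFiniteEntropy
  have hm := measurable_effPotential (P := P) (μ := μ) hW.continuous.measurable
  have hT := logWeight_sub_le_effPotential hW hP hfe
  have := isProbabilityMeasure_gibbs hm hT
  have hG := finiteEntropy_gibbs hm hT
  have hadm : Admissible W (gibbs (effPotential W P μ)) := by
    refine ⟨hG, ?_⟩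
    refine ((integrable_gibbs_self hm hT).add
      ((mutualLog_eq_integral_logPotential hG.integrable_logWeight hfe).1.const_mul
        (2 * P))).congr (ae_of_all _ fun x => ?_)
    simp only [Pi.add_apply, effPotential]
    ring
  refine (gibbs_variational hfe (integrable_exp_neg hm hT)
    (integrable_effPotential hfe hμ.admissible).1).2 ?_
  rw [← entropy_gibbs_add hm hT]
  exact hμ.linearized_le hP.1 hadm

theorem IsMinimizer.density_pos (hW : Confining W P' C) (hP : P ∈ Ioo 0 (P' - 1))
    (hμ : IsMinimizer W P μ) : ∀ᵐ x, 0 < density μ x := by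
  have hfe := hμ.admissible.toFiniteEntropy
  have hZ := integral_exp_pos (integrable_exp_neg
    (measurable_effPotential (P := P) (μ := μ) hW.continuous.measurable)
    (logWeight_sub_le_effPotential hW hP hfe))
  filter_upwards [hμ.density_eq hW hP] with x hx
  rw [hx]
  exact div_pos (Real.exp_pos _) hZ

theorem IsMinimizer.log_density (hW : Confining W P' C) (hP : P ∈ Ioo 0 (P' - 1))
    (hμ : IsMinimizer W P μ) :
    ∀ᵐ x, Real.log (density μ x) = 2 * P * logPotential μ x - W x
      - Real.log (∫ y, Real.exp (-effPotential W P μ y)) := by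
  have hfe := hμ.admissible.toFiniteEntropy
  have hZ := integral_exp_pos (integrable_exp_neg
    (measurable_effPotential (P := P) (μ := μ) hW.continuous.measurable)
    (logWeight_sub_le_effPotential hW hP hfe))
  filter_upwards [hμ.density_eq hW hP] with x hx
  rw [hx, Real.log_div (Real.exp_pos _).ne' hZ.ne', Real.log_exp, effPotential]
  ring

theorem IsMinimizer.support_eq (hW : Confining W P' C) (hP : P ∈ Ioo 0 (P' - 1))
    (hμ : IsMinimizer W P μ) : μ.support = univ := by
  refine eq_univ_of_forall fun x => Measure.mem_support_iff_forall x |>.2 fun U hU => ?_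
  refine pos_iff_ne_zero.2 fun h0 => ?_
  obtain ⟨V, hVU, hV, hxV⟩ := mem_nhds_iff.1 hU
  have hV0 : μ V = 0 := measure_mono_null hVU h0
  rw [← withDensity_density hμ.admissible.ac, withDensity_apply _ hV.measurableSet,
    lintegral_eq_zero_iff (measurable_density μ).ennreal_ofReal] at hV0
  have h1 : ∀ᵐ y ∂(volume.restrict V), False := by
    filter_upwards [hV0, ae_restrict_of_ae (hμ.density_pos hW hP)] with y h1 h2
    simp only [Pi.zero_apply, ENNReal.ofReal_eq_zero] at h1
    exact absurd h2 (not_lt.2 h1)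
  have h2 : volume.restrict V = 0 := by simpa using h1
  exact (hV.measure_pos volume ⟨x, hxV⟩).ne' (Measure.restrict_eq_zero.1 h2)

/-! ### Estimates uniform in the parameter -/

/-- Comparison of the minimizer with the uniform distribution on `[0, 1]`. -/
theorem IsMinimizer.integral_logWeight_le (hW : Confining W P' C) (hP : P ∈ Ioo 0 (P' - 1))
    (hμ : IsMinimizer W P μ) :
    ∫ x, logWeight x ∂μ ≤ 4 * (|∫ x, W x ∂unif| + P' * negLogBound unif - C
      + Real.log refMass) := by
  have h1 := energy_lower_bound hW hP hμ.admissible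
  have h2 := hμ.le unif inferInstance (admissible_unif hW.continuous)
  have h3 : energy W P unif ≤ |∫ x, W x ∂unif| + P' * negLogBound unif := by
    have h4 := mul_le_mul_of_nonneg_left (neg_negLogBound_le_mutualLog
      finiteEntropy_unif.integrable_logWeight finiteEntropy_unif) hP.1.le
    have h5 := mul_nonneg (by linarith [hP.2] : 0 ≤ P' - P) (negLogBound_nonneg unif)
    rw [energy, entropy_unif]
    linarith [le_abs_self (∫ x, W x ∂unif)]
  linarith

/-- A lower bound for the partition function, from the Gibbs variational principle tested on the
uniform distribution. -/
theorem IsMinimizer.neg_log_partition_le (hW : Confining W P' C) (hP : P ∈ Ioo 0 (P' - 1))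
    (hμ : IsMinimizer W P μ) :
    -Real.log (∫ y, Real.exp (-effPotential W P μ y))
      ≤ |∫ x, W x ∂unif| + 2 * P' * negLogBound unif := by
  have hfe := hμ.admissible.toFiniteEntropy
  have hu := admissible_unif hW.continuous
  obtain ⟨i₁, e₁⟩ := integrable_effPotential (P := P) hfe hu
  have h1 := (gibbs_variational finiteEntropy_unif (integrable_exp_neg
    (measurable_effPotential (P := P) (μ := μ) hW.continuous.measurable)
    (logWeight_sub_le_effPotential hW hP hfe)) i₁).1
  have h2 := mul_le_mul_of_nonneg_left (neg_negLogBound_le_mutualLog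
    hfe.integrable_logWeight finiteEntropy_unif) hP.1.le
  have h3 := mul_nonneg (by linarith [hP.2] : 0 ≤ P' - P) (negLogBound_nonneg unif)
  rw [e₁, entropy_unif, mutualLog_comm] at h1
  linarith [le_abs_self (∫ x, W x ∂unif)]

end eulerLagrange

section uniform
variable {W : ℝ → ℝ} {P' C : ℝ}

/-- The densities of all minimizers decay at least like `(1 + x²)^{-(P' - P)}`, with a constant
that depends on `W` only. -/
theorem exists_density_bound (hW : Confining W P' C) : ∃ D : ℝ, 0 < D ∧
    ∀ P ∈ Ioo 0 (P' - 1), ∀ μ : Measure ℝ, IsProbabilityMeasure μ → IsMinimizer W P μ →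
      ∀ᵐ x, density μ x ≤ D * Real.exp (-((P' - P) * logWeight x)) := by
  set z := |∫ x, W x ∂unif| + 2 * P' * negLogBound unif
  set m := 4 * (|∫ x, W x ∂unif| + P' * negLogBound unif - C + Real.log refMass)
  refine ⟨Real.exp (z + P' * m - C), Real.exp_pos _, fun P hP μ _ hμ => ?_⟩
  have hfe := hμ.admissible.toFiniteEntropy
  have hm := hμ.integral_logWeight_le hW hP
  have hz := hμ.neg_log_partition_le hW hP
  have hZ := integral_exp_pos (integrable_exp_neg
    (measurable_effPotential (P := P) (μ := μ) hW.continuous.measurable)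
    (logWeight_sub_le_effPotential hW hP hfe))
  filter_upwards [hμ.density_eq hW hP] with x hx
  rw [← Real.exp_log hZ, ← Real.exp_sub] at hx
  rw [hx, ← Real.exp_add]
  refine Real.exp_le_exp.2 ?_
  have h1 := le_effPotential hW hP hfe x
  have h2 : P * ∫ y, logWeight y ∂μ ≤ P' * m := by
    have h3 := integral_logWeight_nonneg μ
    have h4 : 0 < P' := by linarith [hP.1, hP.2]
    calc P * ∫ y, logWeight y ∂μ ≤ P' * ∫ y, logWeight y ∂μ := by
          gcongr; linarith [hP.2]
      _ ≤ P' * m := by gcongr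
  linarith

/-- The logarithmic potentials of all minimizers grow at most logarithmically, uniformly in the
parameter. -/
theorem exists_logPotential_bound (hW : Confining W P' C) : ∃ κ : ℝ, 0 ≤ κ ∧
    ∀ P ∈ Ioo 0 (P' - 1), ∀ μ : Measure ℝ, IsProbabilityMeasure μ → IsMinimizer W P μ →
      (∫ x, logWeight x ∂μ) ≤ κ ∧ ∀ x, |logPotential μ x| ≤ κ * (1 + logWeight x) := by
  obtain ⟨D, hD, hbound⟩ := exists_density_bound hW
  set m := 4 * (|∫ x, W x ∂unif| + P' * negLogBound unif - C + Real.log refMass)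
  have hS : 0 ≤ ∫ z, sqrtSing z := integral_nonneg sqrtSing_nonneg
  set S := ∫ z, sqrtSing z
  refine ⟨|m| + D * (2 * S) + 1, by positivity, fun P hP μ _ hμ => ?_⟩
  have hfe := hμ.admissible.toFiniteEntropy
  have hm := hμ.integral_logWeight_le hW hP
  have hm' : ∫ x, logWeight x ∂μ ≤ |m| := hm.trans (le_abs_self m)
  have hDS : 0 ≤ D * (2 * S) := by positivity
  refine ⟨by linarith, fun x => ?_⟩
  have hl := logWeight_nonneg x
  have hup := logPotential_le hfe x
  have hlow : -(D * (2 * S)) ≤ logPotential μ x := by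
    have h1 : ∫ y, negLog (x - y) ∂μ ≤ D * (2 * S) := by
      have hi : Integrable (fun y => D * (2 * sqrtSing (x - y))) :=
        ((integrable_sqrtSing.comp_sub_left x).const_mul 2).const_mul D
      have e : D * (2 * S) = ∫ y, D * (2 * sqrtSing (x - y)) := by
        rw [integral_const_mul, integral_const_mul, integral_sub_left_eq_self]
      rw [e, ← integral_density_mul hfe.ac]
      refine integral_mono_ae ((integrable_density_mul_iff hfe.ac).2 (integral_negLog_le hfe x).1)
        hi ?_
      filter_upwards [hbound P hP μ inferInstance hμ] with y hy
      have h2 := mul_negLog_le zero_le_one (x - y)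
      simp only [Real.log_one, mul_zero, abs_zero, zero_add, one_mul] at h2
      have h3 : density μ y ≤ D := by
        refine hy.trans (mul_le_of_le_one_right hD.le (Real.exp_le_one_iff.2 ?_))
        have := mul_nonneg (by linarith [hP.2] : 0 ≤ P' - P) (logWeight_nonneg y)
        linarith
      exact mul_le_mul h3 h2 (negLog_nonneg _) hD.le
    have h2 : -∫ y, Real.log |x - y| ∂μ ≤ ∫ y, negLog (x - y) ∂μ := by
      rw [← integral_neg]
      exact integral_mono (integrable_log_abs_sub hfe x).neg (integral_negLog_le hfe x).1
        fun y => le_max_left _ _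
    unfold logPotential
    linarith
  have hk : 0 ≤ (|m| + D * (2 * S)) * logWeight x := by positivity
  exact abs_le.2 ⟨by linarith [abs_nonneg m], by linarith [abs_nonneg m]⟩

/-- The slope of the free energy in the parameter is bounded along the minimizers. -/
theorem exists_mutualLog_bound (hW : Confining W P' C) : ∃ L : ℝ, 0 ≤ L ∧
    ∀ P ∈ Ioo 0 (P' - 1), ∀ μ : Measure ℝ, IsProbabilityMeasure μ → IsMinimizer W P μ →
      |mutualLog μ μ| ≤ L := by
  obtain ⟨κ, hκ, h⟩ := exists_logPotential_bound hW
  refine ⟨κ * (1 + κ), by positivity, fun P hP μ _ hμ => ?_⟩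
  obtain ⟨h1, h2⟩ := h P hP μ inferInstance hμ
  have hl := hμ.admissible.integrable_logWeight
  obtain ⟨hi, he⟩ := mutualLog_eq_integral_logPotential hl hμ.admissible.toFiniteEntropy
  have e : ∫ x, κ * (1 + logWeight x) ∂μ = κ * (1 + ∫ x, logWeight x ∂μ) := by
    rw [integral_const_mul, integral_add (integrable_const _) hl]
    simp
  rw [he]
  calc |∫ x, logPotential μ x ∂μ| ≤ ∫ x, |logPotential μ x| ∂μ := abs_integral_le_integral_abs
    _ ≤ ∫ x, κ * (1 + logWeight x) ∂μ :=
        integral_mono hi.abs (((integrable_const _).add hl).const_mul κ) h2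
    _ ≤ κ * (1 + κ) := by rw [e]; gcongr

/-- The chi-squared type divergence on the left is dominated by the symmetrized
relative entropy. -/
theorem sq_div_add_le {a b : ℝ} (ha : 0 < a) (hb : 0 < b) :
    (b - a) ^ 2 / (a + b) ≤ (b - a) * (Real.log b - Real.log a) := by
  wlog hab : a ≤ b generalizing a b
  · have := this hb ha (le_of_not_ge hab)
    rw [add_comm b a] at this
    calc (b - a) ^ 2 / (a + b) = (a - b) ^ 2 / (a + b) := by ring
      _ ≤ (a - b) * (Real.log a - Real.log b) := this
      _ = _ := by ring
  have h1 := Real.log_le_sub_one_of_pos (div_pos ha hb)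
  rw [Real.log_div ha.ne' hb.ne'] at h1
  have h2 : (b - a) / (a + b) ≤ Real.log b - Real.log a := by
    have h3 : (b - a) / (a + b) ≤ (b - a) / b :=
      div_le_div_of_nonneg_left (by linarith) hb (by linarith)
    have h4 : (b - a) / b = 1 - a / b := by field_simp
    linarith
  calc (b - a) ^ 2 / (a + b) = (b - a) * ((b - a) / (a + b)) := by ring
    _ ≤ _ := mul_le_mul_of_nonneg_left h2 (by linarith)

/-- The Cauchy–Schwarz inequality, in the form that pairs a test function with the difference of
two densities at the price of their symmetrized relative entropy. -/
theorem mul_sub_le_sq_add {a b : ℝ} (ha : 0 < a) (hb : 0 < b) (h : ℝ) :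
    h * (b - a) ≤ h ^ 2 / 4 * (a + b) + (b - a) * (Real.log b - Real.log a) := by
  refine le_trans ?_ (add_le_add_right (sq_div_add_le ha hb) _)
  have hab : 0 < a + b := by linarith
  rw [← sub_le_iff_le_add', le_div_iff₀ hab]
  nlinarith [sq_nonneg (b - a - h / 2 * (a + b))]

/-- Lipschitz dependence of the minimizers on the parameter, in squared form. -/
theorem exists_logEnergyDiff_bound (hW : Confining W P' C) : ∃ H : ℝ, 0 ≤ H ∧
    ∀ P₁ ∈ Ioo 0 (P' - 1), ∀ P₂ ∈ Ioo 0 (P' - 1), ∀ μ ν : Measure ℝ,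
      IsProbabilityMeasure μ → IsProbabilityMeasure ν → IsMinimizer W P₁ μ → IsMinimizer W P₂ ν →
      (P₁ + P₂) * logEnergyDiff μ ν ≤ H * (P₂ - P₁) ^ 2 := by
  obtain ⟨κ, hκ, hU⟩ := exists_logPotential_bound hW
  obtain ⟨D, hD, hρ⟩ := exists_density_bound hW
  have hR : 0 ≤ refMass := integral_nonneg fun _ => (Real.exp_pos _).le
  refine ⟨128 * κ ^ 2 * D * refMass, by positivity, ?_⟩
  intro P₁ hP₁ P₂ hP₂ μ ν _ _ hμ hν
  have fμ := hμ.admissible.toFiniteEntropy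
  have fν := hν.admissible.toFiniteEntropy
  obtain ⟨i₁, e₁⟩ := mutualLog_eq_integral_logPotential fμ.integrable_logWeight fμ
  obtain ⟨i₂, e₂⟩ := mutualLog_eq_integral_logPotential fμ.integrable_logWeight fν
  obtain ⟨i₃, e₃⟩ := mutualLog_eq_integral_logPotential fν.integrable_logWeight fμ
  obtain ⟨i₄, e₄⟩ := mutualLog_eq_integral_logPotential fν.integrable_logWeight fν
  have j₁ := (integrable_density_mul_iff fμ.ac).2 i₁
  have j₂ := (integrable_density_mul_iff fμ.ac).2 i₂
  have j₃ := (integrable_density_mul_iff fν.ac).2 i₃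
  have j₄ := (integrable_density_mul_iff fν.ac).2 i₄
  rw [← integral_density_mul fμ.ac] at e₁ e₂
  rw [← integral_density_mul fν.ac] at e₃ e₄
  have d₁ : Integrable (density μ) := integrable_density
  have d₂ : Integrable (density ν) := integrable_density
  set c := Real.log (∫ y, Real.exp (-effPotential W P₁ μ y))
    - Real.log (∫ y, Real.exp (-effPotential W P₂ ν y))
  -- by the Euler–Lagrange equations, the cross terms in `(b - a) * (ln b - ln a)` reduce to
  -- mutual energies
  have key : ∀ᵐ x, (P₁ + P₂) * (density ν x * logPotential μ x + density μ x * logPotential ν x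
        - density ν x * logPotential ν x - density μ x * logPotential μ x)
      - c * (density ν x - density μ x)
      ≤ (P₂ - P₁) ^ 2 * (128 * κ ^ 2 * D * Real.exp (-(3 / 4 * logWeight x))) := by
    filter_upwards [hμ.log_density hW hP₁, hν.log_density hW hP₂, hμ.density_pos hW hP₁,
      hν.density_pos hW hP₂, hρ P₁ hP₁ μ inferInstance hμ, hρ P₂ hP₂ ν inferInstance hν]
      with x h1 h2 ha hb hDa hDb
    have hUμ := (hU P₁ hP₁ μ inferInstance hμ).2 x
    have hUν := (hU P₂ hP₂ ν inferInstance hν).2 x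
    have hl := logWeight_nonneg x
    set a := density μ x
    set b := density ν x
    set u := logPotential μ x
    set v := logPotential ν x
    set l := logWeight x
    have hmain := mul_sub_le_sq_add ha hb ((P₂ - P₁) * (u + v))
    rw [h1, h2] at hmain
    have hab : a + b ≤ 2 * D * Real.exp (-l) := by
      have h3 : ∀ P ∈ Ioo 0 (P' - 1), D * Real.exp (-((P' - P) * l)) ≤ D * Real.exp (-l) := by
        intro P hP
        gcongr
        nlinarith [hP.2]
      linarith [hDa.trans (h3 P₁ hP₁), hDb.trans (h3 P₂ hP₂)]
    have huv : (u + v) ^ 2 ≤ 4 * κ ^ 2 * (64 * Real.exp (l / 4)) := by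
      have h3 : |u + v| ≤ 2 * κ * (8 * Real.exp (l / 8)) := by
        have h4 : 1 + l ≤ 8 * Real.exp (l / 8) := by
          linarith [Real.add_one_le_exp (l / 8)]
        calc |u + v| ≤ |u| + |v| := abs_add_le u v
          _ ≤ 2 * κ * (1 + l) := by linarith
          _ ≤ _ := by gcongr
      have h5 : Real.exp (l / 4) = Real.exp (l / 8) ^ 2 := by
        rw [← Real.exp_nat_mul]; congr 1; push_cast; ring
      calc (u + v) ^ 2 = |u + v| ^ 2 := (sq_abs _).symm
        _ ≤ (2 * κ * (8 * Real.exp (l / 8))) ^ 2 := by gcongr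
        _ = _ := by rw [h5]; ring
    have hprod : (u + v) ^ 2 / 4 * (a + b) ≤ 128 * κ ^ 2 * D * Real.exp (-(3 / 4 * l)) := by
      calc (u + v) ^ 2 / 4 * (a + b)
          ≤ 4 * κ ^ 2 * (64 * Real.exp (l / 4)) / 4 * (2 * D * Real.exp (-l)) := by gcongr
        _ = 128 * κ ^ 2 * D * (Real.exp (l / 4) * Real.exp (-l)) := by ring
        _ = _ := by rw [← Real.exp_add]; congr 2; ring
    have hscaled := mul_le_mul_of_nonneg_left hprod (sq_nonneg (P₂ - P₁))
    linarith
  have k₁ : Integrable (fun x => density ν x * logPotential μ x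
      + density μ x * logPotential ν x) := j₃.add j₂
  have k₂ : Integrable (fun x => density ν x * logPotential μ x
      + density μ x * logPotential ν x - density ν x * logPotential ν x) := k₁.sub j₄
  have k₃ : Integrable (fun x => density ν x * logPotential μ x + density μ x * logPotential ν x
      - density ν x * logPotential ν x - density μ x * logPotential μ x) := k₂.sub j₁
  have k₄ : Integrable (fun x => c * (density ν x - density μ x)) := (d₂.sub d₁).const_mul c
  have k₅ : Integrable (fun x => (P₂ - P₁) ^ 2
      * (128 * κ ^ 2 * D * Real.exp (-(3 / 4 * logWeight x)))) :=
    ((integrable_exp_neg_mul_logWeight (a := 3 / 4) (by norm_num)).const_mul _).const_mul _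
  have k₆ : Integrable (fun x => (P₁ + P₂) * (density ν x * logPotential μ x
      + density μ x * logPotential ν x - density ν x * logPotential ν x
      - density μ x * logPotential μ x) - c * (density ν x - density μ x)) :=
    (k₃.const_mul (P₁ + P₂)).sub k₄
  have := integral_mono_ae k₆ k₅ key
  rw [integral_sub (k₃.const_mul (P₁ + P₂)) k₄, integral_const_mul, integral_const_mul,
    integral_const_mul, integral_const_mul, integral_sub k₂ j₁, integral_sub k₁ j₄,
    integral_add j₃ j₂, integral_sub d₂ d₁, ← e₁, ← e₂, ← e₃, ← e₄, integral_density fμ.ac,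
    integral_density fν.ac] at this
  rw [logEnergyDiff]
  change _ ≤ (P₂ - P₁) ^ 2 * (128 * κ ^ 2 * D * refMass) at this
  linarith

end uniform

/-! ### The rate function -/

section rate
variable {W : ℝ → ℝ} {P' C P : ℝ}

theorem freeEnergy_ne_top_iff (hW : Confining W P' C) (hP : P ∈ Ioo 0 (P' - 1)) {ν : Measure ℝ}
    [IsProbabilityMeasure ν] : freeEnergy W P ν ≠ ⊤ ↔ Admissible W ν := by
  refine ⟨fun h => Admissible.of_freeEnergy_ne_top hW.continuous.measurable hP.1
    (by linarith [hP.2]) hW.lower h, fun h => ?_⟩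
  rw [freeEnergy_of_admissible h]
  exact EReal.coe_ne_top _

/-- Measures that are not admissible have infinite free energy, so the infimum over all probability
measures is the least energy of an admissible one. -/
theorem infFreeEnergy_eq (hW : Confining W P' C) (hP : P ∈ Ioo 0 (P' - 1)) {μ : Measure ℝ}
    [hprob : IsProbabilityMeasure μ] (hμ : IsMinimizer W P μ) :
    infFreeEnergy W P = ((energy W P μ : ℝ) : EReal) := by
  refine le_antisymm ?_ (le_iInf fun ν => ?_)
  · rw [← freeEnergy_of_admissible hμ.admissible]
    exact iInf_le (fun ν : ProbabilityMeasure ℝ => freeEnergy W P ν) ⟨μ, hprob⟩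
  · by_cases h : freeEnergy W P (ν : Measure ℝ) = ⊤
    · rw [h]; exact le_top
    · have hadm := (freeEnergy_ne_top_iff hW hP).1 h
      rw [freeEnergy_of_admissible hadm]
      exact EReal.coe_le_coe_iff.2 (hμ.le _ inferInstance hadm)

theorem rateFunction_of_admissible (hW : Confining W P' C) (hP : P ∈ Ioo 0 (P' - 1))
    {μ ν : Measure ℝ} [IsProbabilityMeasure μ] [IsProbabilityMeasure ν] (hμ : IsMinimizer W P μ)
    (hν : Admissible W ν) :
    rateFunction W P ν = ((energy W P ν - energy W P μ : ℝ) : EReal) := by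
  rw [rateFunction, infFreeEnergy_eq hW hP hμ, freeEnergy_of_admissible hν, EReal.coe_sub]

theorem rateFunction_eq_top_iff (hW : Confining W P' C) (hP : P ∈ Ioo 0 (P' - 1))
    {μ ν : Measure ℝ} [IsProbabilityMeasure μ] [IsProbabilityMeasure ν] (hμ : IsMinimizer W P μ) :
    rateFunction W P ν = ⊤ ↔ ¬ Admissible W ν := by
  constructor
  · intro h hadm
    rw [rateFunction_of_admissible hW hP hμ hadm] at h
    exact EReal.coe_ne_top _ h
  · intro h
    rw [← freeEnergy_ne_top_iff hW hP, not_not] at h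
    rw [rateFunction, infFreeEnergy_eq hW hP hμ, h]
    exact EReal.top_sub_coe _

theorem strictlyConvexOnProb_rateFunction (hW : Confining W P' C) (hP : P ∈ Ioo 0 (P' - 1)) :
    StrictlyConvexOnProb (rateFunction W P) := by
  obtain ⟨ξ, _, hξ, hξmin⟩ := exists_minimizer hW hP
  have hmin : IsMinimizer W P ξ := ⟨hξ, hξmin⟩
  intro μ ν t ht0 ht1
  have hmix := isProbabilityMeasure_mix (μ := (μ : Measure ℝ)) (ν := (ν : Measure ℝ)) ht0.le ht1.le
  change rateFunction W P (mix t μ ν) ≤ _ ∧ (_ → _ → _ → rateFunction W P (mix t μ ν) < _)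
  have hnn : ∀ ρ : Measure ℝ, IsProbabilityMeasure ρ → 0 ≤ rateFunction W P ρ := by
    intro ρ _
    by_cases h : Admissible W ρ
    · rw [rateFunction_of_admissible hW hP hmin h]
      exact EReal.coe_nonneg.2 (sub_nonneg.2 (hξmin ρ inferInstance h))
    · rw [(rateFunction_eq_top_iff hW hP hmin).2 h]
      exact le_top
  by_cases hμ : Admissible W (μ : Measure ℝ)
  swap
  · rw [(rateFunction_eq_top_iff hW hP hmin).2 hμ, EReal.coe_mul_top_of_pos ht0,
      EReal.top_add_of_ne_bot]
    · exact ⟨le_top, fun _ h => absurd rfl h⟩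
    · exact (lt_of_lt_of_le EReal.bot_lt_zero
        (mul_nonneg (EReal.coe_nonneg.2 (by linarith)) (hnn ν inferInstance))).ne'
  by_cases hν : Admissible W (ν : Measure ℝ)
  swap
  · rw [(rateFunction_eq_top_iff hW hP hmin).2 hν, EReal.coe_mul_top_of_pos (by linarith),
      EReal.add_top_of_ne_bot]
    · exact ⟨le_top, fun _ _ h => absurd rfl h⟩
    · exact (lt_of_lt_of_le EReal.bot_lt_zero
        (mul_nonneg (EReal.coe_nonneg.2 ht0.le) (hnn μ inferInstance))).ne'
  rw [rateFunction_of_admissible hW hP hmin (hμ.mix hν ht0 ht1),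
    rateFunction_of_admissible hW hP hmin hμ, rateFunction_of_admissible hW hP hmin hν,
    ← EReal.coe_mul, ← EReal.coe_mul, ← EReal.coe_add, EReal.coe_le_coe_iff,
    EReal.coe_lt_coe_iff, energy_mix hμ hν ht0 ht1]
  have hgap := entropy_mix_le hμ.toFiniteEntropy hν.toFiniteEntropy ht0 ht1
  have hcoef : 0 < t * (1 - t) * P := mul_pos (mul_pos ht0 (sub_pos.2 ht1)) hP.1
  refine ⟨?_, fun hne _ _ => ?_⟩
  · have := mul_nonneg hcoef.le (logEnergyDiff_nonneg hμ.toFiniteEntropy hν.toFiniteEntropy)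
    linarith
  · have hne' : (μ : Measure ℝ) ≠ ν := fun h => hne (Subtype.ext h)
    have := mul_pos hcoef (logEnergyDiff_pos hμ.toFiniteEntropy hν.toFiniteEntropy hne')
    linarith

theorem IsMinimizer.unique (hP : P ∈ Ioo 0 (P' - 1)) {μ ν : Measure ℝ}
    [IsProbabilityMeasure μ] [IsProbabilityMeasure ν] (hμ : IsMinimizer W P μ)
    (hν : IsMinimizer W P ν) : ν = μ := by
  by_contra hne
  have fμ := hμ.admissible.toFiniteEntropy
  have fν := hν.admissible.toFiniteEntropy
  have h1 := energy_mix hν.admissible hμ.admissible (t := 1 / 2) (by norm_num) (by norm_num) P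
  have h2 := entropy_mix_le fν fμ (t := 1 / 2) (by norm_num) (by norm_num)
  have h3 := mul_pos hP.1 (logEnergyDiff_pos fν fμ hne)
  have hmix := isProbabilityMeasure_mix (μ := ν) (ν := μ) (t := 1 / 2) (by norm_num) (by norm_num)
  have h4 := hν.admissible.mix hμ.admissible (t := 1 / 2) (by norm_num) (by norm_num)
  linarith [hμ.le _ hmix h4, hν.le _ hmix h4]

theorem energy_eq_add (W : ℝ → ℝ) (P₁ P₂ : ℝ) (μ : Measure ℝ) :
    energy W P₁ μ = energy W P₂ μ + (P₂ - P₁) * mutualLog μ μ := by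
  unfold energy; ring

/-- The infimum of the free energy is Lipschitz, since the free energy is affine in the parameter
with slope `-∬ ln |x - y| dμ dμ`, which is bounded along the minimizers. -/
theorem lipschitzOnWith_infFreeEnergy (hW : Confining W P' C) : ∃ L : ℝ≥0,
    LipschitzOnWith L (fun P => (infFreeEnergy W P).toReal) (Ioo 0 (P' - 1)) := by
  obtain ⟨L, hL, hbound⟩ := exists_mutualLog_bound hW
  refine ⟨⟨L, hL⟩, LipschitzOnWith.of_le_add_mul _ fun P₁ hP₁ P₂ hP₂ => ?_⟩
  obtain ⟨μ, hpμ, hμ, hμmin⟩ := exists_minimizer hW hP₁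
  obtain ⟨ν, hpν, hν, hνmin⟩ := exists_minimizer hW hP₂
  rw [infFreeEnergy_eq hW hP₁ ⟨hμ, hμmin⟩, infFreeEnergy_eq hW hP₂ ⟨hν, hνmin⟩, EReal.toReal_coe,
    EReal.toReal_coe, Real.dist_eq]
  have h1 := hμmin ν inferInstance hν
  rw [energy_eq_add W P₁ P₂ ν] at h1
  have h2 : (P₂ - P₁) * mutualLog ν ν ≤ L * |P₁ - P₂| := by
    calc (P₂ - P₁) * mutualLog ν ν ≤ |(P₂ - P₁) * mutualLog ν ν| := le_abs_self _
      _ = |mutualLog ν ν| * |P₁ - P₂| := by rw [abs_mul, abs_sub_comm, mul_comm]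
      _ ≤ L * |P₁ - P₂| := by
          gcongr
          exact hbound P₂ hP₂ ν hpν ⟨hν, hνmin⟩
  change _ ≤ _ + L * _
  linarith

/-- Lipschitz dependence of the minimizers in the distance `logDist`. -/
theorem exists_logDist_bound (hW : Confining W P' C) : ∃ c : ℝ,
    ∀ P₁ ∈ Ioo 0 (P' - 1), ∀ P₂ ∈ Ioo 0 (P' - 1), ∀ μ ν : Measure ℝ,
      IsProbabilityMeasure μ → IsProbabilityMeasure ν → IsMinimizer W P₁ μ → IsMinimizer W P₂ ν →
      logDist μ ν ≤ ENNReal.ofReal (c / min P₁ P₂ * |P₁ - P₂|) := by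
  obtain ⟨H, hH, hbound⟩ := exists_logEnergyDiff_bound hW
  refine ⟨Real.sqrt (H * |P'|), fun P₁ hP₁ P₂ hP₂ μ ν _ _ hμ hν => ?_⟩
  have fμ := hμ.admissible.toFiniteEntropy
  have fν := hν.admissible.toFiniteEntropy
  have h := hbound P₁ hP₁ P₂ hP₂ μ ν inferInstance inferInstance hμ hν
  rw [logDist_eq_sqrt μ ν (finiteMutualLog fμ.integrable_logWeight fμ)
    (finiteMutualLog fμ.integrable_logWeight fν) (finiteMutualLog fν.integrable_logWeight fν)]
  have hmin : 0 < min P₁ P₂ := lt_min hP₁.1 hP₂.1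
  refine ENNReal.ofReal_le_ofReal (Real.sqrt_le_iff.2 ⟨by positivity, ?_⟩)
  rw [mul_pow, div_pow, Real.sq_sqrt (by positivity), sq_abs, div_mul_eq_mul_div,
    le_div_iff₀ (by positivity)]
  have h1 : min P₁ P₂ ^ 2 ≤ (P₁ + P₂) * |P'| := by
    rw [sq]
    have h2 : min P₁ P₂ ≤ P₁ := min_le_left _ _
    exact mul_le_mul (by linarith [hP₂.1]) (by linarith [hP₁.2, le_abs_self P']) hmin.le
      (by linarith [hP₁.1, hP₂.1])
  calc logEnergyDiff μ ν * min P₁ P₂ ^ 2 ≤ logEnergyDiff μ ν * ((P₁ + P₂) * |P'|) :=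
        mul_le_mul_of_nonneg_left h1 (logEnergyDiff_nonneg fμ fν)
    _ = (P₁ + P₂) * logEnergyDiff μ ν * |P'| := by ring
    _ ≤ H * (P₂ - P₁) ^ 2 * |P'| := by gcongr
    _ = H * |P'| * (P₁ - P₂) ^ 2 := by ring

theorem exp_neg_mul_logWeight_le {q r : ℝ} (hq : 0 ≤ q) (hqr : q ≤ r) (x : ℝ) :
    Real.exp (-(q * logWeight x)) ≤ Real.exp (r * Real.log 2) * (|x| + 1) ^ (-(2 * q)) := by
  have h0 : 0 < |x| + 1 := by positivity
  rw [Real.rpow_def_of_pos h0, ← Real.exp_add]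
  refine Real.exp_le_exp.2 ?_
  have h1 : 2 * Real.log (|x| + 1) ≤ Real.log 2 + logWeight x := by
    rw [logWeight, ← Real.log_mul (by norm_num) (by positivity),
      show 2 * Real.log (|x| + 1) = Real.log ((|x| + 1) ^ 2) by rw [Real.log_pow]; norm_num]
    refine Real.log_le_log (by positivity) ?_
    nlinarith [sq_nonneg (|x| - 1), sq_abs x]
  have h2 := mul_le_mul_of_nonneg_left h1 hq
  have h3 := mul_le_mul_of_nonneg_right hqr (Real.log_nonneg one_le_two)
  linarith

end rate

end CoulombGas
end

theorem lemma3p2 (W : ℝ → ℝ) (hW : ContDiff ℝ 1 W) (P' C : ℝ)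
    (hlow : ∀ x : ℝ, P' * Real.log (|x| ^ 2 + 1) + C ≤ W x) :
    -- strict convexity of the rate function (with a finite infimum)
    (∀ P ∈ Ioo 0 (P' - 1),
      CoulombGas.infFreeEnergy W P ≠ ⊤ ∧ CoulombGas.infFreeEnergy W P ≠ ⊥ ∧
      CoulombGas.StrictlyConvexOnProb (CoulombGas.rateFunction W P)) ∧
    -- the minimizers
    (∃ μ : ℝ → ProbabilityMeasure ℝ,
      (∀ P ∈ Ioo 0 (P' - 1),
        (∀ ν : ProbabilityMeasure ℝ,
          CoulombGas.rateFunction W P (μ P) ≤ CoulombGas.rateFunction W P ν) ∧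
        (∀ ν : ProbabilityMeasure ℝ,
          (∀ ξ : ProbabilityMeasure ℝ,
            CoulombGas.rateFunction W P ν ≤ CoulombGas.rateFunction W P ξ) → ν = μ P) ∧
        (μ P : Measure ℝ) ≪ volume ∧
        (∀ x : ℝ, Integrable (fun y => Real.log |x - y|) (μ P : Measure ℝ)) ∧
        (∃ lam : ℝ, ∀ᵐ x ∂(volume : Measure ℝ),
          0 < CoulombGas.density (μ P) x ∧
          W x - 2 * P * (∫ y, Real.log |x - y| ∂(μ P : Measure ℝ))
            + Real.log (CoulombGas.density (μ P) x) = lam) ∧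
        (μ P : Measure ℝ).support = Set.univ) ∧
      -- polynomial bound on the density, locally uniform in the parameter
      (∃ c : ℝ → ℝ,
        (∀ K : Set ℝ, IsCompact K → K ⊆ Ioo 0 (P' - 1) → BddAbove (c '' K)) ∧
        ∀ P ∈ Ioo 0 (P' - 1), ∀ᵐ x ∂(volume : Measure ℝ),
          CoulombGas.density (μ P) x ≤ c P * (|x| + 1) ^ (2 * (P - P'))) ∧
      -- Lipschitz dependence in the distance `D`, and both formulas for `D` make sense here
      (∀ P₁ ∈ Ioo 0 (P' - 1), ∀ P₂ ∈ Ioo 0 (P' - 1),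
        CoulombGas.FiniteMutualLog (μ P₁) (μ P₂)) ∧
      (∀ R : ℝ, ∃ CR : ℝ, ∀ P₁ ∈ Ioo 0 (P' - 1), ∀ P₂ ∈ Ioo 0 (P' - 1), P₁ ≤ R → P₂ ≤ R →
        CoulombGas.logDist (μ P₁) (μ P₂) ≤ ENNReal.ofReal (CR / min P₁ P₂ * |P₁ - P₂|))) ∧
    -- Lipschitz dependence of the infimum
    (∃ L : ℝ≥0,
      LipschitzOnWith L (fun P => (CoulombGas.infFreeEnergy W P).toReal) (Ioo 0 (P' - 1))) ∧
    -- `D` is an extended distance on probability measures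
    (∀ μ ν : ProbabilityMeasure ℝ, CoulombGas.logDist μ ν = 0 ↔ μ = ν) ∧
    (∀ μ ν : ProbabilityMeasure ℝ, CoulombGas.logDist μ ν = CoulombGas.logDist ν μ) ∧
    (∀ μ ν ξ : ProbabilityMeasure ℝ,
      CoulombGas.logDist μ ξ ≤ CoulombGas.logDist μ ν + CoulombGas.logDist ν ξ) ∧
    -- the two formulas for `D` agree where the first one makes sense
    (∀ μ ν : ProbabilityMeasure ℝ,
      CoulombGas.FiniteMutualLog μ μ → CoulombGas.FiniteMutualLog μ ν →
      CoulombGas.FiniteMutualLog ν ν →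
        0 ≤ CoulombGas.logEnergyDiff μ ν ∧
        CoulombGas.logDist μ ν
          = ENNReal.ofReal (Real.sqrt (CoulombGas.logEnergyDiff μ ν))) := by
  have hC : CoulombGas.Confining W P' C := by
    refine ⟨hW.continuous, fun x => ?_⟩
    have := hlow x
    rwa [sq_abs, add_comm (x ^ 2)] at this
  have hex : ∀ P : ℝ, ∃ μ : ProbabilityMeasure ℝ,
      P ∈ Ioo 0 (P' - 1) → CoulombGas.IsMinimizer W P (μ : Measure ℝ) := by
    intro P
    by_cases hP : P ∈ Ioo 0 (P' - 1)
    · obtain ⟨μ, h1, h2, h3⟩ := CoulombGas.exists_minimizer hC hP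
      exact ⟨⟨μ, h1⟩, fun _ => ⟨h2, h3⟩⟩
    · exact ⟨⟨CoulombGas.unif, inferInstance⟩, fun h => absurd h hP⟩
  choose μ hμ using hex
  refine ⟨fun P hP => ?_, ⟨μ, fun P hP => ?_, ?_, ?_, ?_⟩,
    CoulombGas.lipschitzOnWith_infFreeEnergy hC, fun μ ν => ?_, fun μ ν => ?_, fun μ ν ξ => ?_,
    fun μ ν hμμ hμν hνν => ?_⟩
  · rw [CoulombGas.infFreeEnergy_eq hC hP (hμ P hP)]
    exact ⟨EReal.coe_ne_top _, EReal.coe_ne_bot _,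
      CoulombGas.strictlyConvexOnProb_rateFunction hC hP⟩
  · have hmin := hμ P hP
    have hfe := hmin.admissible.toFiniteEntropy
    refine ⟨fun ν => ?_, fun ν hν => ?_, hfe.ac, fun x => CoulombGas.integrable_log_abs_sub hfe x,
      ⟨-Real.log (∫ y, Real.exp (-CoulombGas.effPotential W P (μ P) y)), ?_⟩,
      hmin.support_eq hC hP⟩
    · by_cases h : CoulombGas.Admissible W (ν : Measure ℝ)
      · rw [CoulombGas.rateFunction_of_admissible hC hP hmin h,
          CoulombGas.rateFunction_of_admissible hC hP hmin hmin.admissible,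
          EReal.coe_le_coe_iff]
        linarith [hmin.le ν inferInstance h]
      · rw [(CoulombGas.rateFunction_eq_top_iff hC hP hmin).2 h]
        exact le_top
    · have hadm : CoulombGas.Admissible W (ν : Measure ℝ) := by
        by_contra h
        have h1 := hν (μ P)
        rw [(CoulombGas.rateFunction_eq_top_iff hC hP hmin).2 h, top_le_iff,
          CoulombGas.rateFunction_eq_top_iff hC hP hmin] at h1
        exact h1 hmin.admissible
      have hνmin : CoulombGas.IsMinimizer W P (ν : Measure ℝ) := by
        refine ⟨hadm, fun ξ hξ h => ?_⟩
        have h1 := hν ⟨ξ, hξ⟩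
        rw [CoulombGas.rateFunction_of_admissible hC hP hmin hadm, ProbabilityMeasure.coe_mk,
          CoulombGas.rateFunction_of_admissible hC hP hmin h, EReal.coe_le_coe_iff] at h1
        linarith
      have he : (ν : Measure ℝ) = μ P := hmin.unique hP hνmin
      exact Subtype.ext he
    · filter_upwards [hmin.density_pos hC hP, hmin.log_density hC hP] with x h1 h2
      refine ⟨h1, ?_⟩
      rw [h2, CoulombGas.logPotential]
      ring
  · obtain ⟨D, hD, hbound⟩ := CoulombGas.exists_density_bound hC
    refine ⟨fun _ => D * Real.exp (P' * Real.log 2), fun K _ _ =>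
      ⟨D * Real.exp (P' * Real.log 2), by rintro _ ⟨P, _, rfl⟩; exact le_rfl⟩, fun P hP => ?_⟩
    filter_upwards [hbound P hP (μ P) inferInstance (hμ P hP)] with x hx
    refine hx.trans ?_
    rw [mul_assoc, show 2 * (P - P') = -(2 * (P' - P)) by ring]
    exact mul_le_mul_of_nonneg_left (CoulombGas.exp_neg_mul_logWeight_le
      (by linarith [hP.2]) (by linarith [hP.1]) x) hD.le
  · intro P₁ hP₁ P₂ hP₂
    exact CoulombGas.finiteMutualLog (hμ P₁ hP₁).admissible.integrable_logWeight
      (hμ P₂ hP₂).admissible.toFiniteEntropy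
  · obtain ⟨c, hc⟩ := CoulombGas.exists_logDist_bound hC
    exact fun _ => ⟨c, fun P₁ hP₁ P₂ hP₂ _ _ =>
      hc P₁ hP₁ P₂ hP₂ _ _ inferInstance inferInstance (hμ P₁ hP₁) (hμ P₂ hP₂)⟩
  · refine ⟨fun h => ?_, ?_⟩
    · have he : (μ : Measure ℝ) = ν := CoulombGas.eq_of_logDist_eq_zero h
      exact Subtype.ext he
    rintro rfl
    exact CoulombGas.logDist_self _
  · exact CoulombGas.logDist_comm _ _
  · exact CoulombGas.logDist_triangle _ _ _
  · exact ⟨(CoulombGas.logEnergyDiff_eq_lintegral _ _ hμμ hμν hνν).1,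
      CoulombGas.logDist_eq_sqrt _ _ hμμ hμν hνν⟩
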